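/- Let $\mathscr X$ be a complex manifold of dimension $r$ with a Kähler metric $G_{i\bar j}$, and suppose it is special Kähler, i.e. $\mathscr X$ is covered by holomorphic coordinate systems $a=(a^1,\dots,a^r)$ ("special coordinates"), each with a holomorphic prepotential $\mathcal F(a)$ such that in these coordinates $$G_{i\bar j}=2\,\mathrm{Im}\,\frac{\partial^2\mathcal F}{\partial a^i\partial a^j},$$ and on overlaps the vectors $(\partial\mathcal F/\partial a^i,\,a^i)$ of two such systems are related locally by a constant matrix in $Sp(2r,\mathbb R)$ followed by a constant complex shift. Let $$Y=-i\,\frac{\partial^3\mathcal F}{\partial a^i\partial a^j\partial a^k}\,da^i\otimes da^j\otimes da^k .$$ For a Kähler metric write, in arbitrary holomorphic coordinates, $R_{i\bar jk\bar l}=-\partial_k\partial_{\bar l}G_{i\bar j}+G^{\bar n m}\,\partial_kG_{i\bar n}\,\partial_{\bar l}G_{m\bar j}$ for the Riemann tensor, where $G^{\bar nm}$ is the inverse matrix of $G_{m\bar n}$; $R_{k\bar l}=G^{\bar ji}R_{i\bar jk\bar l}$ for the Ricci tensor; and $R=G^{\bar lk}R_{k\bar l}$ for the scalar curvature. Then $Y$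 is a well-defined (independent of the choice of special coordinates) holomorphic symmetric cubic form on $\mathscr X$, and in all holomorphic coordinates $$R_{i\bar jk\bar l}=G^{\bar nm}\,Y_{ikm}\,\overline{Y_{jln}} .$$ Moreover: (1) The Riemann tensor is Nakano non-negative, i.e. $R_{i\bar jk\bar l}\,u^{ik}\,\overline{u^{jl}}\ge 0$ for all tensors $u^{ij}$; hence the holomorphic bisectional curvatures $R_{i\bar jk\bar l}v^i\bar v^{j}w^k\bar w^{l}/(\|v\|^2\|w\|^2)$, for $v,w\neq0$, and the Ricci curvature are non-negative. (2) The scalar curvature is $R=\|Y\|^2:=Y_{ijk}\,G^{\bar l i}G^{\bar m j}G^{\bar n k}\,\overline{Y_{lmn}}$. Hence if $R$ vanishes at a point $p$, then $Y$ vanishes at $p$, and the full Riemann tensor vanishes at $p$. (3) The scalar curvature $R$ is a plurisubharmonic function: it is smooth and the matrix $\partial_i\partial_{\bar j}R$ is non-negative in all holomorphic coordinates. -/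

import Mathlib

open scoped Manifold ContDiff ComplexConjugate ComplexOrder Topology

noncomputable section

namespace SpecialKahler

/-- The model space `ℂ^r` of an `r`-dimensional complex manifold. -/
abbrev Cn (r : ℕ) : Type := Fin r → ℂ

section Derivatives

variable {r : ℕ}

/-- Complex partial derivative `∂f/∂z^i` of a holomorphic function. -/
def holPartial (i : Fin r) (f : Cn r → ℂ) (z : Cn r) : ℂ :=
  fderiv ℂ f z (Pi.single i 1)

/-- Wirtinger derivative `∂_i f = (∂f/∂x^i - √-1 ∂f/∂y^i) / 2`, where `z^i = x^i + √-1 y^i`,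
of a real-differentiable function. -/
def dz (i : Fin r) (f : Cn r → ℂ) (z : Cn r) : ℂ :=
  (fderiv ℝ f z (Pi.single i 1) - Complex.I * fderiv ℝ f z (Pi.single i Complex.I)) / 2

/-- Wirtinger derivative `∂_{ī} f = (∂f/∂x^i + √-1 ∂f/∂y^i) / 2`. -/
def dzbar (i : Fin r) (f : Cn r → ℂ) (z : Cn r) : ℂ :=
  (fderiv ℝ f z (Pi.single i 1) + Complex.I * fderiv ℝ f z (Pi.single i Complex.I)) / 2

end Derivatives

section Manifold

variable {r : ℕ} {M : Type*} [TopologicalSpace M] [ChartedSpace (Cn r) M]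

variable (r M) in
/-- The holomorphic coordinate charts of the complex manifold `M`. -/
abbrev holCharts : Set (OpenPartialHomeomorph M (Cn r)) :=
  IsManifold.maximalAtlas 𝓘(ℂ, Cn r) ω M


/-- The coordinate vector field `∂/∂z^i` of the chart `e`, at the point with coordinates `z`. -/
def coordVec (e : OpenPartialHomeomorph M (Cn r)) (z : Cn r) (i : Fin r) :
    TangentSpace 𝓘(ℂ, Cn r) (e.symm z) :=
  mfderiv 𝓘(ℂ, Cn r) 𝓘(ℂ, Cn r) e.symm z (Pi.single i 1 : Cn r)

/-- The components of a tangent vector at `p` in the chart `e`. -/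
def vecCoord (e : OpenPartialHomeomorph M (Cn r)) (p : M)
    (v : TangentSpace 𝓘(ℂ, Cn r) p) : Cn r :=
  mfderiv 𝓘(ℂ, Cn r) 𝓘(ℂ, Cn r) e p v

/-- The matrix `G_{i j̄}` of a field of sesquilinear forms in the chart `e`. -/
def formCoeff
    (h : ∀ p : M, TangentSpace 𝓘(ℂ, Cn r) p →ₗ[ℂ] TangentSpace 𝓘(ℂ, Cn r) p →ₗ⋆[ℂ] ℂ)
    (e : OpenPartialHomeomorph M (Cn r)) (z : Cn r) : Matrix (Fin r) (Fin r) ℂ :=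
  Matrix.of fun i j => h (e.symm z) (coordVec e z i) (coordVec e z j)

/-- A smooth function is plurisubharmonic if its complex Hessian `∂_i ∂_{j̄} f` is non-negative
in all holomorphic coordinates. (`0 ≤ w` for `w : ℂ` says that `w` is real and non-negative.) -/
def IsPlurisubharmonic (f : M → ℝ) : Prop :=
  ∀ e ∈ holCharts r M,
    ContDiffOn ℝ ∞ (fun z => f (e.symm z)) e.target ∧
    ∀ z ∈ e.target, ∀ v : Cn r,
      0 ≤ ∑ i, ∑ j, dz i (dzbar j (fun x => (f (e.symm x) : ℂ))) z * v i * conj (v j)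

variable (r M) in
/-- A Kähler metric: a smooth positive definite Hermitian form on the holomorphic tangent bundle,
linear in the first and antilinear in the second argument, whose fundamental form is closed,
that is, `∂_k G_{i j̄} = ∂_i G_{k j̄}`. -/
structure KahlerMetric where
  form : ∀ p : M, TangentSpace 𝓘(ℂ, Cn r) p →ₗ[ℂ] TangentSpace 𝓘(ℂ, Cn r) p →ₗ⋆[ℂ] ℂ
  hermitian : ∀ p u v, form p u v = conj (form p v u)
  pos : ∀ p v, v ≠ 0 → 0 < form p v v
  smooth : ∀ e ∈ holCharts r M, ∀ i j,
    ContDiffOn ℝ ∞ (fun z => formCoeff form e z i j) e.target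
  closed : ∀ e ∈ holCharts r M, ∀ z ∈ e.target, ∀ i j k,
    dz k (fun x => formCoeff form e x i j) z = dz i (fun x => formCoeff form e x k j) z

namespace KahlerMetric

variable (g : KahlerMetric r M) (e : OpenPartialHomeomorph M (Cn r)) (z : Cn r)

/-- The matrix `G_{i j̄}` of the metric in the chart `e`. -/
def coeff : Matrix (Fin r) (Fin r) ℂ := formCoeff g.form e z

/-- The inverse metric: `g.inv e z n m` is `G^{n̄ m}`, with `∑ m, G^{n̄ m} G_{m l̄} = δ_{n l}`. -/
def inv : Matrix (Fin r) (Fin r) ℂ := (g.coeff e z)⁻¹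

/-- The components of the Riemann tensor of the Kähler metric in the chart `e`,
`R_{i j̄ k l̄} = - ∂_k ∂_{l̄} G_{i j̄} + G^{n̄ m} ∂_k G_{i n̄} ∂_{l̄} G_{m j̄}`. -/
def riemann (i j k l : Fin r) : ℂ :=
  - dz k (dzbar l (fun x => g.coeff e x i j)) z +
    ∑ n, ∑ m, g.inv e z n m * dz k (fun x => g.coeff e x i n) z *
      dzbar l (fun x => g.coeff e x m j) z

/-- The Ricci tensor `R_{k l̄} = G^{j̄ i} R_{i j̄ k l̄}`. -/
def ricci (k l : Fin r) : ℂ :=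
  ∑ i, ∑ j, g.inv e z j i * g.riemann e z i j k l

/-- The contraction `G^{l̄ k} R_{k l̄}` in the chart `e`. -/
def scalarIn : ℂ :=
  ∑ k, ∑ l, g.inv e z l k * g.ricci e z k l

/-- The scalar curvature, as a function on `M`, computed at `p` in the preferred chart at `p`. -/
def scalar (p : M) : ℝ :=
  (g.scalarIn (chartAt (Cn r) p) (chartAt (Cn r) p p)).re

/-- Holomorphic bisectional curvature of the tangent vectors `v = v^i ∂_i` and `w = w^k ∂_k`. -/
def bisectional (v w : Cn r) : ℂ :=
  (∑ i, ∑ j, ∑ k, ∑ l, g.riemann e z i j k l * v i * conj (v j) * w k * conj (w l)) /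
    ((∑ i, ∑ j, g.coeff e z i j * v i * conj (v j)) *
      ∑ k, ∑ l, g.coeff e z k l * w k * conj (w l))

/-- Nakano non-negativity: `R_{i j̄ k l̄} u^{ik} ū^{j̄ l̄} ≥ 0` for all tensors `u`. -/
def IsNakanoNonneg : Prop :=
  ∀ e ∈ holCharts r M, ∀ z ∈ e.target, ∀ u : Fin r → Fin r → ℂ,
    0 ≤ ∑ i, ∑ j, ∑ k, ∑ l, g.riemann e z i j k l * u i k * conj (u j l)

/-- All holomorphic bisectional curvatures are non-negative. -/
def IsBisectionalNonneg : Prop :=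
  ∀ e ∈ holCharts r M, ∀ z ∈ e.target, ∀ v w : Cn r, v ≠ 0 → w ≠ 0 →
    0 ≤ g.bisectional e z v w

/-- The Ricci curvature is non-negative. -/
def IsRicciNonneg : Prop :=
  ∀ e ∈ holCharts r M, ∀ z ∈ e.target, ∀ v : Cn r,
    0 ≤ ∑ k, ∑ l, g.ricci e z k l * v k * conj (v l)

end KahlerMetric

/-- Local special coordinates `a^i` for the Kähler metric `g`: a holomorphic chart together with a
holomorphic prepotential `F(a)` such that `G_{i j̄} = 2 Im (∂² F / ∂a^i ∂a^j)`. -/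
structure SpecialCoordinates (g : KahlerMetric r M) where
  chart : OpenPartialHomeomorph M (Cn r)
  chart_mem : chart ∈ holCharts r M
  prepotential : Cn r → ℂ
  holomorphic : DifferentiableOn ℂ prepotential chart.target
  metric_eq : ∀ a ∈ chart.target, ∀ i j,
    g.coeff chart a i j = 2 * ((holPartial i (holPartial j prepotential) a).im : ℂ)

namespace SpecialCoordinates

variable {g : KahlerMetric r M}

/-- The periods `(∂F/∂a^i, a^i)` at a point. -/
def periods (x : SpecialCoordinates g) (p : M) : Fin r ⊕ Fin r → ℂ :=
  Sum.elim (fun i => holPartial i x.prepotential (x.chart p)) (x.chart p)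

/-- On overlaps the periods of two systems of special coordinates are related, locally, by a
constant real symplectic matrix and a constant shift. -/
def Compatible (x y : SpecialCoordinates g) : Prop :=
  ∀ p ∈ x.chart.source ∩ y.chart.source,
    ∃ P ∈ Matrix.symplecticGroup (Fin r) ℝ, ∃ c : Fin r ⊕ Fin r → ℂ,
      ∀ᶠ q in 𝓝 p, y.periods q = (P.map Complex.ofReal).mulVec (x.periods q) + c

/-- `∂³F / ∂a^i ∂a^j ∂a^k` at the point with special coordinates `a`. -/
def thirdDeriv (x : SpecialCoordinates g) (a : Cn r) (i j k : Fin r) : ℂ :=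
  holPartial i (holPartial j (holPartial k x.prepotential)) a

end SpecialCoordinates

/-- A special Kähler structure on a Kähler manifold: a covering by mutually compatible systems of
special coordinates. -/
structure SpecialStructure (g : KahlerMetric r M) where
  systems : Set (SpecialCoordinates g)
  cover : ∀ p : M, ∃ x ∈ systems, p ∈ x.chart.source
  compatible : ∀ x ∈ systems, ∀ y ∈ systems, x.Compatible y

namespace SpecialStructure

variable {g : KahlerMetric r M} (S : SpecialStructure g)

/-- A system of special coordinates around `p`. -/
def systemAt (p : M) : SpecialCoordinates g := (S.cover p).choose

/-- The cubic form `Y = -√-1 (∂³F / ∂a^i ∂a^j ∂a^k) da^i ⊗ da^j ⊗ da^k`, computed at `p` in a chosen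
system of special coordinates around `p`. -/
def cubicForm (p : M) (u v w : TangentSpace 𝓘(ℂ, Cn r) p) : ℂ :=
  ∑ i, ∑ j, ∑ k, -Complex.I * (S.systemAt p).thirdDeriv ((S.systemAt p).chart p) i j k *
    vecCoord (S.systemAt p).chart p u i * vecCoord (S.systemAt p).chart p v j *
    vecCoord (S.systemAt p).chart p w k

/-- The components `Y_{ijk}` in the chart `e`. -/
def Y (e : OpenPartialHomeomorph M (Cn r)) (z : Cn r) (i j k : Fin r) : ℂ :=
  S.cubicForm (e.symm z) (coordVec e z i) (coordVec e z j) (coordVec e z k)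

/-- The Hermitian norm `‖Y‖² = Y_{ijk} G^{l̄ i} G^{m̄ j} G^{n̄ k} Ȳ_{l̄ m̄ n̄}` in the chart `e`. -/
def normSqY (e : OpenPartialHomeomorph M (Cn r)) (z : Cn r) : ℂ :=
  ∑ i, ∑ j, ∑ k, ∑ l, ∑ m, ∑ n,
    S.Y e z i j k * g.inv e z l i * g.inv e z m j * g.inv e z n k * conj (S.Y e z l m n)

end SpecialStructure

end Manifold

end SpecialKahler

end

open SpecialKahler

/-!
In special coordinates the metric is `G = 2 Im τ`, where `τ` is the holomorphic Hessian of the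
prepotential. Hence `∂∂̄G = 0`, and the curvature `∂G G⁻¹ ∂̄G` is a Gram matrix built from `∂τ`,
that is, from `Y`; the Chern curvature is a tensor, so the formula holds in all holomorphic
coordinates. A change of special coordinates has Jacobian `J = C τ + D` and acts on `τ` by the
Siegel action `σ = (A τ + B) (C τ + D)⁻¹`. Differentiating `σ J = A τ + B` and using the symplectic
relations gives `Jᵀ dσ J = dτ`, which is the invariance of `Y`.

The curvature formula contracts to `R = ‖Y‖²`. For plurisubharmonicity, put `H = 2 Im τ` and let
`H₀ = 2 Im τ₀` be its value at a point. The matrix `Q = -√-1 (τ - τ₀ᴴ)` is holomorphic, equals `H₀`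
at that point, and satisfies `H ≤ Q H₀⁻¹ Qᴴ`, because the difference is `D H₀⁻¹ Dᴴ` with
`D = -√-1 (τ - τ₀)`. Replacing `H⁻¹` by `(Q H₀⁻¹ Qᴴ)⁻¹` in `‖Y‖²` bounds `R` from below by a sum of
squared moduli of holomorphic functions, with equality at the point, so the Levi form of `R` there
dominates that of a plurisubharmonic function.
-/

noncomputable section

namespace SpecialKahler

section Holomorphy

variable {E F : Type*} [NormedAddCommGroup E] [NormedSpace ℂ E]
  [NormedAddCommGroup F] [NormedSpace ℂ F] {f : E → F} {z : E}

lemma norm_fderiv_le_of_forall_mem_ball_norm_le {R C : ℝ} (hR : 0 < R)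
    (hd : DifferentiableOn ℂ f (Metric.ball z R)) (hC : ∀ w ∈ Metric.ball z R, ‖f w‖ ≤ C) :
    ‖fderiv ℂ f z‖ ≤ 2 * C / R := by
  refine Complex.norm_fderiv_le_div_of_mapsTo_ball hd (fun w hw => ?_) hR
  rw [mem_closedBall_iff_norm]
  linarith [norm_sub_le (f w) (f z), hC w hw, hC z (Metric.mem_ball_self hR)]

lemma exists_lipschitzOnWith_ball (hf : ∀ᶠ w in 𝓝 z, DifferentiableAt ℂ f w) :
    ∃ R > 0, ∃ K, LipschitzOnWith K f (Metric.ball z R) ∧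
      ∀ w ∈ Metric.ball z R, DifferentiableAt ℂ f w := by
  have hbound : ∀ᶠ w in 𝓝 z, ‖f w‖ < ‖f z‖ + 1 :=
    hf.self_of_nhds.continuousAt.norm.eventually_lt continuousAt_const (lt_add_one _)
  obtain ⟨R, hR, hball⟩ := Metric.eventually_nhds_iff_ball.1 (hf.and hbound)
  have hhalf : Metric.ball z (R / 2) ⊆ Metric.ball z R := Metric.ball_subset_ball (by linarith)
  have hfderiv : ∀ w ∈ Metric.ball z (R / 2), ‖fderiv ℂ f w‖ ≤ 2 * (‖f z‖ + 1) / (R / 2) := by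
    intro w hw
    have hsub : Metric.ball w (R / 2) ⊆ Metric.ball z R :=
      Metric.ball_subset_ball' (by rw [Metric.mem_ball] at hw; linarith)
    exact norm_fderiv_le_of_forall_mem_ball_norm_le (by positivity)
      (fun x hx => (hball x (hsub hx)).1.differentiableWithinAt)
      fun x hx => (hball x (hsub hx)).2.le
  refine ⟨R / 2, by positivity, (2 * (‖f z‖ + 1) / (R / 2)).toNNReal, ?_,
    fun w hw => (hball w (hhalf hw)).1⟩
  refine (convex_ball z (R / 2)).lipschitzOnWith_of_nnnorm_fderiv_le (𝕜 := ℂ)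
    (fun w hw => (hball w (hhalf hw)).1) fun w hw => ?_
  exact NNReal.coe_le_coe.1 ((hfderiv w hw).trans (Real.le_coe_toNNReal _))

-- The Cauchy estimate is applied to `x ↦ f (x + (y - w)) - f x`, which is `O(‖y - w‖)`.
lemma exists_lipschitzOnWith_fderiv_ball (hf : ∀ᶠ w in 𝓝 z, DifferentiableAt ℂ f w) :
    ∃ R > 0, ∃ K, LipschitzOnWith K (fderiv ℂ f) (Metric.ball z R) ∧
      ∀ w ∈ Metric.ball z R, DifferentiableAt ℂ f w := by
  obtain ⟨R, hR, K, hK, hd⟩ := exists_lipschitzOnWith_ball hf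
  refine ⟨R / 4, by positivity, (2 * K / (R / 4)).toNNReal,
    LipschitzOnWith.of_dist_le_mul fun y hy w hw => ?_,
    fun w hw => hd w (Metric.ball_subset_ball (by linarith) hw)⟩
  have hshift : ∀ x ∈ Metric.ball w (R / 4),
      x ∈ Metric.ball z R ∧ x + (y - w) ∈ Metric.ball z R := by
    intro x hx
    rw [mem_ball_iff_norm] at hx hy hw
    have hx' : ‖x - z‖ ≤ ‖x - w‖ + ‖w - z‖ := norm_sub_le_norm_sub_add_norm_sub x w z
    have hxy : ‖x + (y - w) - z‖ ≤ ‖x - w‖ + ‖y - z‖ :=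
      (congrArg norm (by abel)).trans_le (norm_add_le (x - w) (y - z))
    simp only [mem_ball_iff_norm]
    constructor <;> linarith
  have hw0 : w ∈ Metric.ball w (R / 4) := Metric.mem_ball_self (by positivity)
  have hdy : ∀ x ∈ Metric.ball w (R / 4), DifferentiableAt ℂ (fun x => f (x + (y - w))) x :=
    fun x hx => (differentiableAt_comp_add_right (y - w)).2 (hd _ (hshift x hx).2)
  have hfderiv : fderiv ℂ (fun x => f (x + (y - w)) - f x) w = fderiv ℂ f y - fderiv ℂ f w := by
    rw [fderiv_fun_sub (hdy w hw0) (hd _ (hshift w hw0).1), fderiv_comp_add_right, add_sub_cancel]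
  have hnorm : ∀ x ∈ Metric.ball w (R / 4), ‖f (x + (y - w)) - f x‖ ≤ K * dist y w := by
    intro x hx
    simpa [dist_eq_norm] using hK.dist_le_mul _ (hshift x hx).2 _ (hshift x hx).1
  rw [dist_eq_norm, ← hfderiv, Real.coe_toNNReal _ (by positivity)]
  refine (norm_fderiv_le_of_forall_mem_ball_norm_le (by positivity) (fun x hx =>
    ((hdy x hx).sub (hd _ (hshift x hx).1)).differentiableWithinAt) hnorm).trans_eq (by ring)

lemma norm_differenceQuotient_sub_fderiv_le {R : ℝ} {K : NNReal} {w v : E} {t : ℂ}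
    (hK : LipschitzOnWith K (fderiv ℂ f) (Metric.ball z R))
    (hd : ∀ w ∈ Metric.ball z R, DifferentiableAt ℂ f w) (ht : t ≠ 0)
    (hw : w ∈ Metric.ball z (R / 2)) (htv : ‖t • v‖ < R / 2) :
    ‖t⁻¹ • (f (w + t • v) - f w) - fderiv ℂ f w v‖ ≤ K * ‖v‖ ^ 2 * ‖t‖ := by
  have hball : Metric.closedBall w ‖t • v‖ ⊆ Metric.ball z R :=
    Metric.closedBall_subset_ball' (by rw [Metric.mem_ball] at hw; linarith)
  have hmean : ‖f (w + t • v) - f w - fderiv ℂ f w (w + t • v - w)‖ ≤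
      K * ‖t • v‖ * ‖w + t • v - w‖ := by
    refine Convex.norm_image_sub_le_of_norm_fderiv_le' (𝕜 := ℂ)
      (fun x hx => hd x (hball hx)) (fun x hx => ?_) (convex_closedBall w ‖t • v‖)
      (by simp) (by simp)
    have hlip := hK.dist_le_mul x (hball hx) w (hball (by simp))
    rw [dist_eq_norm] at hlip
    exact hlip.trans (by gcongr; exact hx)
  rw [add_sub_cancel_left, map_smul] at hmean
  have hquot : t⁻¹ • (f (w + t • v) - f w) - fderiv ℂ f w v =
      t⁻¹ • (f (w + t • v) - f w - t • fderiv ℂ f w v) := by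
    rw [smul_sub t⁻¹ (f (w + t • v) - f w), inv_smul_smul₀ ht]
  calc ‖t⁻¹ • (f (w + t • v) - f w) - fderiv ℂ f w v‖
      ≤ ‖t‖⁻¹ * (K * ‖t • v‖ * ‖t • v‖) := by
        rw [hquot, norm_smul, norm_inv]
        gcongr
    _ = K * ‖v‖ ^ 2 * ‖t‖ := by
        rw [norm_smul]
        field_simp [norm_ne_zero_iff.2 ht]

lemma uniformCauchySeqOn_fderiv {ι : Type*} {l : Filter ι} {φ : ι → E → F} {R : ℝ} (hR : 0 < R)
    (hφ : UniformCauchySeqOn φ l (Metric.ball z R))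
    (hd : ∀ᶠ n in l, DifferentiableOn ℂ (φ n) (Metric.ball z R)) :
    UniformCauchySeqOn (fun n => fderiv ℂ (φ n)) l (Metric.ball z (R / 2)) := by
  intro u hu
  obtain ⟨ε, hε, hεu⟩ := Metric.mem_uniformity_dist.1 hu
  have hδ : 0 < ε * R / 8 := by positivity
  filter_upwards [hφ _ (Metric.dist_mem_uniformity hδ), hd.prod_mk hd] with ⟨m, n⟩ hmn hdmn w hw
  have hsub : Metric.ball w (R / 2) ⊆ Metric.ball z R :=
    Metric.ball_subset_ball' (by rw [Metric.mem_ball] at hw; linarith)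
  have hwR : Metric.ball z R ∈ 𝓝 w :=
    Metric.isOpen_ball.mem_nhds (Metric.ball_subset_ball (by linarith) hw)
  refine hεu ?_
  rw [dist_eq_norm, ← fderiv_sub (hdmn.1.differentiableAt hwR) (hdmn.2.differentiableAt hwR)]
  refine (norm_fderiv_le_of_forall_mem_ball_norm_le (half_pos hR)
    ((hdmn.1.sub hdmn.2).mono hsub) fun x hx => ?_).trans_lt
      (by field_simp; norm_num : 2 * (ε * R / 8) / (R / 2) < ε)
  exact (dist_eq_norm (φ m x) (φ n x)).symm.trans_le (le_of_lt (hmn x (hsub hx)))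

lemma differentiableAt_of_tendstoUniformlyOn_ball [CompleteSpace F] {ι : Type*} {l : Filter ι}
    [l.NeBot] {φ : ι → E → F} {R : ℝ} (hR : 0 < R)
    (hφ : TendstoUniformlyOn φ f l (Metric.ball z R))
    (hd : ∀ᶠ n in l, DifferentiableOn ℂ (φ n) (Metric.ball z R)) : DifferentiableAt ℂ f z := by
  have hcauchy := uniformCauchySeqOn_fderiv hR hφ.uniformCauchySeqOn hd
  have hlim : ∀ w, ∃ L, w ∈ Metric.ball z (R / 2) →
      Filter.Tendsto (fun n => fderiv ℂ (φ n) w) l (𝓝 L) := by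
    intro w
    by_cases hw : w ∈ Metric.ball z (R / 2)
    · obtain ⟨L, hL⟩ := CompleteSpace.complete (hcauchy.cauchy_map hw)
      exact ⟨L, fun _ => hL⟩
    · exact ⟨0, fun h => absurd h hw⟩
  choose f' hf' using hlim
  have hball : ∀ ρ > 0, Metric.ball z ρ ∈ 𝓝 z := fun ρ hρ => Metric.ball_mem_nhds z hρ
  refine (hasFDerivAt_of_tendstoUniformlyOnFilter (f := φ) (l := l) (g' := f')
    ((hcauchy.tendstoUniformlyOn_of_tendsto hf').tendstoUniformlyOnFilter.mono_right
      (Filter.le_principal_iff.2 (hball _ (half_pos hR)))) ?_ ?_).differentiableAt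
  · filter_upwards [hd.prod_mk (hball R hR)] with p hp
    obtain ⟨hdp, hpz⟩ := hp
    exact (hdp.differentiableAt (Metric.isOpen_ball.mem_nhds hpz)).hasFDerivAt
  · filter_upwards [hball R hR] with w hw using hφ.tendsto_at hw

lemma differentiableAt_fderiv_apply [CompleteSpace F]
    (hf : ∀ᶠ w in 𝓝 z, DifferentiableAt ℂ f w) (v : E) :
    DifferentiableAt ℂ (fun w => fderiv ℂ f w v) z := by
  obtain ⟨R, hR, K, hK, hd⟩ := exists_lipschitzOnWith_fderiv_ball hf
  have hsmall : ∀ᶠ t : ℂ in 𝓝[≠] 0, t ≠ 0 ∧ ‖t • v‖ < R / 2 := by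
    refine eventually_mem_nhdsWithin.and (eventually_nhdsWithin_of_eventually_nhds ?_)
    exact (by fun_prop : Continuous fun t : ℂ => ‖t • v‖).continuousAt.eventually_lt
      continuousAt_const (by simpa using half_pos hR)
  refine differentiableAt_of_tendstoUniformlyOn_ball (half_pos hR) (l := 𝓝[≠] (0 : ℂ))
    (φ := fun t w => t⁻¹ • (f (w + t • v) - f w)) ?_ ?_
  · rw [Metric.tendstoUniformlyOn_iff]
    intro ε hε
    have hlim : ∀ᶠ t : ℂ in 𝓝[≠] 0, K * ‖v‖ ^ 2 * ‖t‖ < ε :=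
      eventually_nhdsWithin_of_eventually_nhds <|
        (by fun_prop : Continuous fun t : ℂ => K * ‖v‖ ^ 2 * ‖t‖).continuousAt.eventually_lt
          continuousAt_const (by simpa using hε)
    filter_upwards [hsmall, hlim] with t ht hlt w hw
    rw [dist_eq_norm']
    exact (norm_differenceQuotient_sub_fderiv_le hK hd ht.1 hw ht.2).trans_lt hlt
  · filter_upwards [hsmall] with t ht w hw
    have hw' : w ∈ Metric.ball z R := Metric.ball_subset_ball (by linarith) hw
    have htw : w + t • v ∈ Metric.ball z R := by
      rw [mem_ball_iff_norm] at hw ⊢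
      have h := norm_add_le (w - z) (t • v)
      rw [sub_add_eq_add_sub] at h
      linarith [ht.2]
    exact ((((differentiableAt_comp_add_right (t • v)).2 (hd _ htw)).sub
      (hd w hw')).const_smul t⁻¹).differentiableWithinAt

theorem contDiffAt_infty_of_eventually_differentiableAt [FiniteDimensional ℂ E] [CompleteSpace F]
    (hf : ∀ᶠ w in 𝓝 z, DifferentiableAt ℂ f w) : ContDiffAt ℂ ∞ f z := by
  suffices h : ∀ (n : ℕ) (f : E → F) (U : Set E), IsOpen U → DifferentiableOn ℂ f U →
      ContDiffOn ℂ n f U by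
    obtain ⟨U, hU, hUo, hzU⟩ := eventually_nhds_iff.1 hf
    exact contDiffAt_infty.2 fun n => (h n f U hUo fun w hw =>
      (hU w hw).differentiableWithinAt).contDiffAt (hUo.mem_nhds hzU)
  intro n
  induction n with
  | zero => exact fun f U _ hf => contDiffOn_zero.2 hf.continuousOn
  | succ n ih =>
    intro f U hU hf
    have hnear : ∀ w ∈ U, ∀ᶠ x in 𝓝 w, DifferentiableAt ℂ f x := fun w hw =>
      hf.eventually_differentiableAt (hU.mem_nhds hw)
    refine (contDiffOn_succ_iff_fderiv_of_isOpen hU).2 ⟨hf, by simp, contDiffOn_clm_apply.2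
      fun v => ih _ U hU fun w hw =>
        (differentiableAt_fderiv_apply (hnear w hw) v).differentiableWithinAt⟩

lemma eventually_contDiffAt_infty [FiniteDimensional ℂ E] [CompleteSpace F]
    (hf : ContDiffAt ℂ 1 f z) : ∀ᶠ w in 𝓝 z, ContDiffAt ℂ ∞ f w := by
  filter_upwards [eventually_eventually_nhds.2 (hf.eventually (by simp))] with w hw
  exact contDiffAt_infty_of_eventually_differentiableAt
    (hw.mono fun x hx => hx.differentiableAt one_ne_zero)

end Holomorphy

section PartialDerivatives

variable {r : ℕ} {f g : Cn r → ℂ} {z : Cn r}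

lemma holPartial_congr (h : f =ᶠ[𝓝 z] g) (i : Fin r) : holPartial i f z = holPartial i g z := by
  rw [holPartial, holPartial, h.fderiv_eq]

lemma contDiffAt_holPartial (hf : ContDiffAt ℂ ∞ f z) (i : Fin r) :
    ContDiffAt ℂ ∞ (holPartial i f) z :=
  (hf.fderiv_right le_rfl).clm_apply contDiffAt_const

lemma holPartial_comm (hf : ContDiffAt ℂ 2 f z) (i j : Fin r) :
    holPartial i (holPartial j f) z = holPartial j (holPartial i f) z := by
  have hd : DifferentiableAt ℂ (fderiv ℂ f) z :=
    (hf.fderiv_right (m := 1) (by norm_num)).differentiableAt one_ne_zero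
  have hsnd : ∀ i j, holPartial i (holPartial j f) z =
      fderiv ℂ (fderiv ℂ f) z (Pi.single i 1) (Pi.single j 1) := fun i j => by
    change fderiv ℂ (fun w => fderiv ℂ f w (Pi.single j 1)) z (Pi.single i 1) = _
    rw [fderiv_clm_apply hd (differentiableAt_const _)]
    simp
  rw [hsnd, hsnd]
  exact hf.isSymmSndFDerivAt (by simp) _ _

lemma fderiv_apply_eq_sum_holPartial (f : Cn r → ℂ) (z v : Cn r) :
    fderiv ℂ f z v = ∑ i, holPartial i f z * v i := by
  conv_lhs => rw [pi_eq_sum_univ' v]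
  simp only [map_sum, map_smul, smul_eq_mul, holPartial, mul_comm]

lemma holPartial_comp {s : ℕ} {φ : Cn s → Cn r} {z : Cn s} (hf : DifferentiableAt ℂ f (φ z))
    (hφ : DifferentiableAt ℂ φ z) (k : Fin s) :
    holPartial k (fun w => f (φ w)) z =
      ∑ c, holPartial c f (φ z) * holPartial k (fun w => φ w c) z := by
  change fderiv ℂ (f ∘ φ) z _ = _
  rw [fderiv_comp z hf hφ, ContinuousLinearMap.comp_apply, fderiv_apply_eq_sum_holPartial]
  simp only [holPartial, fderiv_apply hφ, ContinuousLinearMap.comp_apply,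
    ContinuousLinearMap.proj_apply]

lemma dz_eq_holPartial (hf : DifferentiableAt ℂ f z) (i : Fin r) : dz i f z = holPartial i f z := by
  have hI : (Pi.single i Complex.I : Cn r) = Complex.I • Pi.single i 1 := by
    rw [← Pi.single_smul, smul_eq_mul, mul_one]
  rw [dz, hf.fderiv_restrictScalars ℝ, hI]
  simp only [ContinuousLinearMap.coe_restrictScalars', map_smul, smul_eq_mul, ← mul_assoc,
    Complex.I_mul_I, holPartial]
  ring

lemma dzbar_eq_zero (hf : DifferentiableAt ℂ f z) (i : Fin r) : dzbar i f z = 0 := by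
  have hI : (Pi.single i Complex.I : Cn r) = Complex.I • Pi.single i 1 := by
    rw [← Pi.single_smul, smul_eq_mul, mul_one]
  rw [dzbar, hf.fderiv_restrictScalars ℝ, hI]
  simp only [ContinuousLinearMap.coe_restrictScalars', map_smul, smul_eq_mul, ← mul_assoc,
    Complex.I_mul_I]
  ring

lemma dz_conj (f : Cn r → ℂ) (z : Cn r) (i : Fin r) :
    dz i (fun w => conj (f w)) z = conj (dzbar i f z) := by
  have h := Complex.conjCLE.comp_fderiv (f := f) (x := z)
  change fderiv ℝ (fun w => conj (f w)) z = _ at h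
  simp [dz, dzbar, h, sub_eq_add_neg, Complex.conj_ofNat]

lemma dzbar_conj (f : Cn r → ℂ) (z : Cn r) (i : Fin r) :
    dzbar i (fun w => conj (f w)) z = conj (dz i f z) := by
  simpa using congrArg conj (dz_conj (fun w => conj (f w)) z i).symm

end PartialDerivatives

section MatrixDerivatives

variable {E : Type*} [NormedAddCommGroup E] [NormedSpace ℝ E] {r : ℕ}
  {l m n : Type*} {z : E} (δ : Module.Dual ℂ (E →L[ℝ] ℂ))

/-- The Wirtinger derivative `∂_i`, as a functional of the real differential. -/
def del (i : Fin r) : Module.Dual ℂ (Cn r →L[ℝ] ℂ) where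
  toFun φ := (φ (Pi.single i 1) - Complex.I * φ (Pi.single i Complex.I)) / 2
  map_add' φ ψ := by simp only [add_apply]; ring
  map_smul' c φ := by simp only [smul_apply, smul_eq_mul, RingHom.id_apply]; ring

/-- The Wirtinger derivative `∂_{ī}`, as a functional of the real differential. -/
def delbar (i : Fin r) : Module.Dual ℂ (Cn r →L[ℝ] ℂ) where
  toFun φ := (φ (Pi.single i 1) + Complex.I * φ (Pi.single i Complex.I)) / 2
  map_add' φ ψ := by simp only [add_apply]; ring
  map_smul' c φ := by simp only [smul_apply, smul_eq_mul, RingHom.id_apply]; ring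

/-- The entrywise derivative of a matrix-valued function along a complexified tangent vector `δ`,
encoded as a complex-linear functional on real differentials (such as `del i` and `delbar i`). -/
def matDeriv (A : E → Matrix m n ℂ) (z : E) : Matrix m n ℂ :=
  Matrix.of fun i j => δ (fderiv ℝ (fun w => A w i j) z)

lemma matDeriv_del {z : Cn r} (k : Fin r) (A : Cn r → Matrix m n ℂ) (i : m) (j : n) :
    matDeriv (del k) A z i j = dz k (fun w => A w i j) z := rfl

variable {δ}

lemma matDeriv_congr {A B : E → Matrix m n ℂ} (h : A =ᶠ[𝓝 z] B) :
    matDeriv δ A z = matDeriv δ B z := by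
  ext i j
  have hij : (A · i j) =ᶠ[𝓝 z] (B · i j) := h.mono fun w hw => congrFun₂ hw i j
  exact congrArg δ hij.fderiv_eq

lemma matDeriv_add {A B : E → Matrix m n ℂ} (hA : ∀ i j, DifferentiableAt ℝ (A · i j) z)
    (hB : ∀ i j, DifferentiableAt ℝ (B · i j) z) :
    matDeriv δ (fun w => A w + B w) z = matDeriv δ A z + matDeriv δ B z := by
  ext i j
  simp only [matDeriv, Matrix.of_apply, Matrix.add_apply, fderiv_fun_add (hA i j) (hB i j), map_add]

lemma matDeriv_const_smul {A : E → Matrix m n ℂ} (c : ℂ)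
    (hA : ∀ i j, DifferentiableAt ℝ (A · i j) z) :
    matDeriv δ (fun w => c • A w) z = c • matDeriv δ A z := by
  ext i j
  simp only [matDeriv, Matrix.of_apply, Matrix.smul_apply, fderiv_fun_const_smul (hA i j), map_smul]

lemma matDeriv_mul [Fintype m] {A : E → Matrix l m ℂ} {B : E → Matrix m n ℂ}
    (hA : ∀ i j, DifferentiableAt ℝ (A · i j) z) (hB : ∀ i j, DifferentiableAt ℝ (B · i j) z) :
    matDeriv δ (fun w => A w * B w) z = matDeriv δ A z * B z + A z * matDeriv δ B z := by
  ext i j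
  simp only [matDeriv, Matrix.of_apply, Matrix.add_apply, Matrix.mul_apply]
  rw [fderiv_fun_sum fun k _ => (hA i k).fun_mul (hB k j), map_sum, ← Finset.sum_add_distrib]
  refine Finset.sum_congr rfl fun k _ => ?_
  rw [fderiv_fun_mul (hA i k) (hB k j), map_add, map_smul, map_smul, smul_eq_mul, smul_eq_mul]
  ring

end MatrixDerivatives

section MatrixWirtinger

variable {r : ℕ} {l m n : Type*} {A : Cn r → Matrix m n ℂ} {z : Cn r}

lemma dz_eventuallyEq_holPartial {f : Cn r → ℂ} (hf : ContDiffAt ℂ 1 f z) (i : Fin r) :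
    dz i f =ᶠ[𝓝 z] holPartial i f :=
  (hf.eventually (by simp)).mono fun _ hw => dz_eq_holPartial (hw.differentiableAt one_ne_zero) i

lemma eventually_forall_differentiableAt [Finite m] [Finite n]
    (hA : ∀ i j, ContDiffAt ℂ ∞ (A · i j) z) :
    ∀ᶠ w in 𝓝 z, ∀ i j, DifferentiableAt ℂ (A · i j) w := by
  simp only [Filter.eventually_all]
  exact fun i j => (((hA i j).of_le (m := 1) (by simp)).eventually (by simp)).mono fun w hw =>
    hw.differentiableAt one_ne_zero

lemma matDeriv_delbar_eq_zero (hA : ∀ i j, DifferentiableAt ℂ (A · i j) z) (k : Fin r) :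
    matDeriv (delbar k) A z = 0 := by
  ext i j
  exact dzbar_eq_zero (hA i j) k

lemma matDeriv_delbar_conjTranspose (A : Cn r → Matrix m n ℂ) (z : Cn r) (k : Fin r) :
    matDeriv (delbar k) (fun w => (A w).conjTranspose) z =
      (matDeriv (del k) A z).conjTranspose := by
  ext i j
  exact dzbar_conj (A · j i) z k

lemma matDeriv_del_conjTranspose_eq_zero (hA : ∀ i j, DifferentiableAt ℂ (A · i j) z)
    (k : Fin r) : matDeriv (del k) (fun w => (A w).conjTranspose) z = 0 := by
  ext i j
  exact (dz_conj (A · j i) z k).trans (by rw [dzbar_eq_zero (hA j i), map_zero, Matrix.zero_apply])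

lemma differentiableAt_matDeriv_del (hA : ∀ i j, ContDiffAt ℂ ∞ (A · i j) z) (k : Fin r) (i : m)
    (j : n) : DifferentiableAt ℂ (matDeriv (del k) A · i j) z :=
  ((contDiffAt_holPartial (hA i j) k).differentiableAt (by simp)).congr_of_eventuallyEq
    (dz_eventuallyEq_holPartial ((hA i j).of_le (by simp)) k)

lemma differentiableAt_matDeriv (hA : ∀ i j, ContDiffAt ℝ 2 (A · i j) z)
    (δ : Module.Dual ℂ (Cn r →L[ℝ] ℂ)) (i : m) (j : n) :
    DifferentiableAt ℝ (matDeriv δ A · i j) z := by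
  have hfderiv : DifferentiableAt ℝ (fderiv ℝ (A · i j)) z :=
    ((hA i j).fderiv_right (m := 1) (by norm_num)).differentiableAt one_ne_zero
  exact (δ.restrictScalars ℝ).toContinuousLinearMap.differentiableAt.comp z hfderiv

lemma differentiableAt_mul [Fintype m] {𝕜 : Type*} [NontriviallyNormedField 𝕜]
    [NormedAlgebra 𝕜 ℂ] {E : Type*} [NormedAddCommGroup E] [NormedSpace 𝕜 E] {z : E}
    {A : E → Matrix l m ℂ} {B : E → Matrix m n ℂ}
    (hA : ∀ i j, DifferentiableAt 𝕜 (A · i j) z) (hB : ∀ i j, DifferentiableAt 𝕜 (B · i j) z)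
    (i : l) (j : n) : DifferentiableAt 𝕜 (fun w => (A w * B w) i j) z := by
  simp only [Matrix.mul_apply]
  exact DifferentiableAt.fun_sum fun k _ => (hA i k).fun_mul (hB k j)

lemma differentiableAt_conjTranspose (hA : ∀ i j, DifferentiableAt ℝ (A · i j) z) (i : n) (j : m) :
    DifferentiableAt ℝ (fun w => (A w).conjTranspose i j) z :=
  Complex.conjCLE.differentiableAt.comp z (hA j i)

end MatrixWirtinger

section Curvature

variable {r : ℕ} {n : Type*} [Fintype n] {z : Cn r}

lemma matDeriv_delbar_frame {L H : Cn r → Matrix n n ℂ}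
    (hL : ∀ i j, DifferentiableAt ℂ (L · i j) z) (hH : ∀ i j, DifferentiableAt ℝ (H · i j) z)
    (k : Fin r) :
    matDeriv (delbar k) (fun w => L w * H w * (L w).conjTranspose) z =
      L z * (matDeriv (delbar k) H z * (L z).conjTranspose +
        H z * (matDeriv (del k) L z).conjTranspose) := by
  have hLℝ : ∀ i j, DifferentiableAt ℝ (L · i j) z := fun i j => (hL i j).restrictScalars ℝ
  rw [matDeriv_mul (differentiableAt_mul hLℝ hH) (differentiableAt_conjTranspose hLℝ),
    matDeriv_mul hLℝ hH, matDeriv_delbar_eq_zero hL, matDeriv_delbar_conjTranspose]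
  noncomm_ring

lemma matDeriv_del_frame {L H : Cn r → Matrix n n ℂ}
    (hL : ∀ i j, DifferentiableAt ℂ (L · i j) z) (hH : ∀ i j, DifferentiableAt ℝ (H · i j) z)
    (k : Fin r) :
    matDeriv (del k) (fun w => L w * H w * (L w).conjTranspose) z =
      (matDeriv (del k) L z * H z + L z * matDeriv (del k) H z) * (L z).conjTranspose := by
  have hLℝ : ∀ i j, DifferentiableAt ℝ (L · i j) z := fun i j => (hL i j).restrictScalars ℝ
  rw [matDeriv_mul (differentiableAt_mul hLℝ hH) (differentiableAt_conjTranspose hLℝ),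
    matDeriv_mul hLℝ hH, matDeriv_del_conjTranspose_eq_zero hL]
  noncomm_ring

lemma matDeriv_del_delbar_frame {L H : Cn r → Matrix n n ℂ}
    (hL : ∀ i j, ContDiffAt ℂ ∞ (L · i j) z) (hH : ∀ i j, ContDiffAt ℝ 2 (H · i j) z)
    (k l : Fin r) :
    matDeriv (del k) (matDeriv (delbar l) fun w => L w * H w * (L w).conjTranspose) z =
      matDeriv (del k) L z * (matDeriv (delbar l) H z * (L z).conjTranspose +
        H z * (matDeriv (del l) L z).conjTranspose) +
      L z * (matDeriv (del k) (matDeriv (delbar l) H) z * (L z).conjTranspose +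
        matDeriv (del k) H z * (matDeriv (del l) L z).conjTranspose) := by
  have hLℂ := eventually_forall_differentiableAt hL
  have hHℝ : ∀ᶠ w in 𝓝 z, ∀ i j, DifferentiableAt ℝ (H · i j) w := by
    simp only [Filter.eventually_all]
    exact fun i j => ((hH i j).eventually (by simp)).mono fun w hw =>
      hw.differentiableAt two_ne_zero
  have hLℝ : ∀ i j, DifferentiableAt ℝ (L · i j) z := fun i j =>
    (hLℂ.self_of_nhds i j).restrictScalars ℝ
  have hLconj := differentiableAt_conjTranspose hLℝ
  have hL' := differentiableAt_matDeriv_del hL l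
  have hL'conj := differentiableAt_conjTranspose fun i j => (hL' i j).restrictScalars ℝ
  have hH' := differentiableAt_matDeriv hH (delbar l)
  have hfst := differentiableAt_mul hH' hLconj
  have hsnd := differentiableAt_mul hHℝ.self_of_nhds hL'conj
  have hsum : ∀ i j, DifferentiableAt ℝ (fun w => (matDeriv (delbar l) H w * (L w).conjTranspose +
      H w * (matDeriv (del l) L w).conjTranspose) i j) z := fun i j => (hfst i j).fun_add (hsnd i j)
  have hdelbar := hLℂ.and hHℝ |>.mono fun w hw => matDeriv_delbar_frame hw.1 hw.2 l
  rw [matDeriv_congr hdelbar, matDeriv_mul hLℝ hsum, matDeriv_add hfst hsnd,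
    matDeriv_mul hH' hLconj, matDeriv_mul hHℝ.self_of_nhds hL'conj,
    matDeriv_del_conjTranspose_eq_zero hLℂ.self_of_nhds, matDeriv_del_conjTranspose_eq_zero hL',
    Matrix.mul_zero, Matrix.mul_zero, add_zero, add_zero]

variable [DecidableEq n]

/-- The matrix `(R_{i j̄ k l̄})_{i, j}` of the curvature `-∂_k ∂_{l̄} G + ∂_k G ⬝ G⁻¹ ⬝ ∂_{l̄} G` of
the Chern connection of a field `G` of Hermitian matrices. -/
def chernCurvature (k l : Fin r) (G : Cn r → Matrix n n ℂ) (z : Cn r) : Matrix n n ℂ :=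
  -matDeriv (del k) (matDeriv (delbar l) G) z +
    matDeriv (del k) G z * (G z)⁻¹ * matDeriv (delbar l) G z

lemma chernCurvature_congr {G G' : Cn r → Matrix n n ℂ} (h : G =ᶠ[𝓝 z] G') (k l : Fin r) :
    chernCurvature k l G z = chernCurvature k l G' z := by
  have hbar : matDeriv (delbar l) G =ᶠ[𝓝 z] matDeriv (delbar l) G' :=
    h.eventuallyEq_nhds.mono fun w hw => matDeriv_congr hw
  rw [chernCurvature, chernCurvature, matDeriv_congr hbar, matDeriv_congr h, hbar.self_of_nhds,
    h.self_of_nhds]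

lemma conjTranspose_mul_inv_mul {R : Type*} [CommRing R] [StarRing R] {L : Matrix n n R}
    (hL : IsUnit L.det) (H : Matrix n n R) :
    L.conjTranspose * (L * H * L.conjTranspose)⁻¹ * L = H⁻¹ := by
  have hLstar : IsUnit L.conjTranspose.det := by
    rw [Matrix.det_conjTranspose]
    exact hL.star
  rw [Matrix.mul_inv_rev, Matrix.mul_inv_rev, Matrix.mul_nonsing_inv_cancel_left _ _ hLstar,
    Matrix.nonsing_inv_mul_cancel_right _ _ hL]

lemma chernCurvature_frame {L H : Cn r → Matrix n n ℂ} (hL : ∀ i j, ContDiffAt ℂ ∞ (L · i j) z)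
    (hH : ∀ i j, ContDiffAt ℝ 2 (H · i j) z) (hLz : IsUnit (L z).det) (hHz : IsUnit (H z).det)
    (k l : Fin r) :
    chernCurvature k l (fun w => L w * H w * (L w).conjTranspose) z =
      L z * chernCurvature k l H z * (L z).conjTranspose := by
  have hL1 : ∀ i j, DifferentiableAt ℂ (L · i j) z := fun i j =>
    (hL i j).differentiableAt (by simp)
  have hH1 : ∀ i j, DifferentiableAt ℝ (H · i j) z := fun i j =>
    (hH i j).differentiableAt two_ne_zero
  rw [chernCurvature, chernCurvature, matDeriv_del_delbar_frame hL hH, matDeriv_del_frame hL1 hH1,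
    matDeriv_delbar_frame hL1 hH1]
  generalize matDeriv (del k) L z = L_k, (matDeriv (del l) L z).conjTranspose = L_l,
    matDeriv (del k) H z = H_k, matDeriv (delbar l) H z = H_l at *
  have hcurv : (L_k * H z + L z * H_k) * (L z).conjTranspose *
      (L z * H z * (L z).conjTranspose)⁻¹ * (L z * (H_l * (L z).conjTranspose + H z * L_l)) =
      (L_k * H z + L z * H_k) * (H z)⁻¹ * (H_l * (L z).conjTranspose + H z * L_l) := by
    rw [← conjTranspose_mul_inv_mul hLz (H z)]
    simp only [mul_assoc]
  rw [hcurv]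
  simp only [mul_add, add_mul, mul_assoc, mul_neg, neg_mul,
    Matrix.mul_nonsing_inv_cancel_left _ _ hHz, Matrix.nonsing_inv_mul_cancel_left _ _ hHz]
  abel

end Curvature

open Matrix
open scoped Kronecker MatrixOrder

section TwoIm

variable {r : ℕ} {n : Type*} {T : Cn r → Matrix n n ℂ} {z : Cn r}

/-- The Hermitian matrix `2 Im T = -√-1 (T - Tᴴ)`; for symmetric `T` its entries are twice the
imaginary parts of those of `T`. -/
def twoIm (T : Matrix n n ℂ) : Matrix n n ℂ := (-Complex.I) • T + Complex.I • Tᴴ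

lemma twoIm_apply_of_isSymm {T : Matrix n n ℂ} (hT : T.IsSymm) (i j : n) :
    twoIm T i j = 2 * ((T i j).im : ℂ) := by
  rw [twoIm, Matrix.add_apply, Matrix.smul_apply, Matrix.smul_apply, conjTranspose_apply, hT.apply]
  apply Complex.ext <;> simp [two_mul]

lemma twoIm_isSymm {T : Matrix n n ℂ} (hT : T.IsSymm) : (twoIm T).IsSymm := by
  ext i j
  rw [transpose_apply, twoIm_apply_of_isSymm hT, twoIm_apply_of_isSymm hT, hT.apply]

lemma contDiffAt_twoIm (hT : ∀ i j, ContDiffAt ℂ ∞ (T · i j) z) (i j : n) :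
    ContDiffAt ℝ ∞ (fun w => twoIm (T w) i j) z :=
  (contDiffAt_const.mul ((hT i j).restrict_scalars ℝ)).add (contDiffAt_const.mul
    (Complex.conjCLE.contDiff.contDiffAt.comp z ((hT j i).restrict_scalars ℝ)))

lemma matDeriv_twoIm {δ : Module.Dual ℂ (Cn r →L[ℝ] ℂ)}
    (hT : ∀ i j, DifferentiableAt ℂ (T · i j) z) :
    matDeriv δ (fun w => twoIm (T w)) z =
      (-Complex.I) • matDeriv δ T z + Complex.I • matDeriv δ (fun w => (T w)ᴴ) z := by
  have hTℝ : ∀ i j, DifferentiableAt ℝ (T · i j) z := fun i j => (hT i j).restrictScalars ℝ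
  have hTconj := differentiableAt_conjTranspose hTℝ
  unfold twoIm
  rw [matDeriv_add (A := fun w => (-Complex.I) • T w) (B := fun w => Complex.I • (T w)ᴴ)
      (fun i j => (hTℝ i j).const_mul _) (fun i j => (hTconj i j).const_mul _),
    matDeriv_const_smul _ hTℝ, matDeriv_const_smul _ hTconj]

lemma matDeriv_del_twoIm (hT : ∀ i j, DifferentiableAt ℂ (T · i j) z) (k : Fin r) :
    matDeriv (del k) (fun w => twoIm (T w)) z = (-Complex.I) • matDeriv (del k) T z := by
  rw [matDeriv_twoIm hT, matDeriv_del_conjTranspose_eq_zero hT, smul_zero, add_zero]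

lemma matDeriv_delbar_twoIm (hT : ∀ i j, DifferentiableAt ℂ (T · i j) z) (k : Fin r) :
    matDeriv (delbar k) (fun w => twoIm (T w)) z = ((-Complex.I) • matDeriv (del k) T z)ᴴ := by
  rw [matDeriv_twoIm hT, matDeriv_delbar_eq_zero hT, matDeriv_delbar_conjTranspose,
    conjTranspose_smul, smul_zero, zero_add, star_neg, RCLike.star_def, Complex.conj_I, neg_neg]

lemma chernCurvature_twoIm [Fintype n] [DecidableEq n]
    (hT : ∀ i j, ContDiffAt ℂ ∞ (T · i j) z) (k l : Fin r) :
    chernCurvature k l (fun w => twoIm (T w)) z =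
      ((-Complex.I) • matDeriv (del k) T z) * (twoIm (T z))⁻¹ *
        ((-Complex.I) • matDeriv (del l) T z)ᴴ := by
  have hTz : ∀ i j, DifferentiableAt ℂ (T · i j) z := fun i j => (hT i j).differentiableAt (by simp)
  have hpluriharmonic : matDeriv (del k) (matDeriv (delbar l) fun w => twoIm (T w)) z = 0 := by
    rw [matDeriv_congr ((eventually_forall_differentiableAt hT).mono fun w hw =>
      matDeriv_delbar_twoIm hw l)]
    exact matDeriv_del_conjTranspose_eq_zero (A := fun w => (-Complex.I) • matDeriv (del l) T w)
      (fun i j => (differentiableAt_matDeriv_del hT l i j).const_mul _) k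
  rw [chernCurvature, hpluriharmonic, matDeriv_del_twoIm hTz, matDeriv_delbar_twoIm hTz, neg_zero,
    zero_add]

end TwoIm

section CubicForms

variable {ι κ μ : Type*}

/-- The components of a cubic form as a vector. -/
def cubeVec (y : ι → ι → ι → ℂ) : ι × ι × ι → ℂ := fun p => y p.1 p.2.1 p.2.2

/-- The third Kronecker power of a matrix, which acts on the component vectors of cubic forms. -/
def cubeMat (K : Matrix ι κ ℂ) : Matrix (ι × ι × ι) (κ × κ × κ) ℂ := K ⊗ₖ (K ⊗ₖ K)

lemma cubeMat_conjTranspose (A : Matrix ι κ ℂ) : cubeMat Aᴴ = (cubeMat A)ᴴ := by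
  rw [cubeMat, cubeMat, conjTranspose_kronecker, conjTranspose_kronecker]

lemma cubeMat_mono [Finite ι] {K L : Matrix ι ι ℂ} (hL : 0 ≤ L) (hLK : L ≤ K) :
    cubeMat L ≤ cubeMat K := by
  have hK := nonneg_iff_posSemidef.1 (hL.trans hLK)
  rw [nonneg_iff_posSemidef] at hL
  rw [le_iff] at hLK ⊢
  have htelescope : cubeMat K - cubeMat L =
      (K - L) ⊗ₖ (K ⊗ₖ K) + (L ⊗ₖ ((K - L) ⊗ₖ K) + L ⊗ₖ (L ⊗ₖ (K - L))) := by
    ext p q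
    simp only [cubeMat, kroneckerMap_apply, Matrix.sub_apply, Matrix.add_apply]
    ring
  rw [htelescope]
  exact (hLK.kronecker (hK.kronecker hK)).add
    ((hL.kronecker (hLK.kronecker hK)).add (hL.kronecker (hL.kronecker hLK)))

variable [Fintype κ]

lemma cubeMat_mul (A : Matrix ι κ ℂ) (B : Matrix κ μ ℂ) :
    cubeMat (A * B) = cubeMat A * cubeMat B := by
  rw [cubeMat, cubeMat, cubeMat, mul_kronecker_mul, mul_kronecker_mul]

/-- The pull-back of a cubic form along the linear map with matrix `J`. -/
def cubePull (J : Matrix κ ι ℂ) (y : κ → κ → κ → ℂ) : ι → ι → ι → ℂ :=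
  fun i j k => ∑ a, ∑ b, ∑ c, y a b c * J a i * J b j * J c k

lemma cubeVec_cubePull (J : Matrix κ ι ℂ) (y : κ → κ → κ → ℂ) :
    cubeVec (cubePull J y) = cubeMat Jᵀ *ᵥ cubeVec y := by
  ext p
  simp only [cubeVec, cubePull, cubeMat, mulVec, dotProduct, Fintype.sum_prod_type,
    kroneckerMap_apply, transpose_apply]
  refine Finset.sum_congr rfl fun a _ => Finset.sum_congr rfl fun b _ =>
    Finset.sum_congr rfl fun c _ => by ring

lemma cubePull_one [DecidableEq κ] (y : κ → κ → κ → ℂ) : cubePull 1 y = y := by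
  funext i j k
  simp [cubePull, one_apply]

lemma cubePull_smul (J : Matrix κ ι ℂ) (c : ℂ) (y : κ → κ → κ → ℂ) :
    cubePull J (c • y) = c • cubePull J y := by
  funext i j k
  simp [cubePull, Finset.mul_sum, mul_assoc]

variable [Fintype ι]

lemma cubePull_cubePull (J : Matrix ι μ ℂ) (N : Matrix κ ι ℂ) (y : κ → κ → κ → ℂ) :
    cubePull J (cubePull N y) = cubePull (N * J) y := by
  have h : cubeVec (cubePull J (cubePull N y)) = cubeVec (cubePull (N * J) y) := by
    rw [cubeVec_cubePull, cubeVec_cubePull, cubeVec_cubePull, mulVec_mulVec, ← cubeMat_mul,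
      transpose_mul]
  funext i j k
  exact congrFun h (i, j, k)

/-- The squared Hermitian norm `y_{ijk} K^{l̄ i} K^{m̄ j} K^{n̄ k} ȳ_{lmn}` of a cubic form `y` with
respect to the inverse metric `K`. -/
def cubeNorm (K : Matrix ι ι ℂ) (y : ι → ι → ι → ℂ) : ℂ :=
  star (cubeVec y) ⬝ᵥ (cubeMat K *ᵥ cubeVec y)

lemma cubeNorm_eq_sum (K : Matrix ι ι ℂ) (y : ι → ι → ι → ℂ) :
    cubeNorm K y = ∑ i, ∑ j, ∑ k, ∑ l, ∑ m, ∑ n,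
      y i j k * K l i * K m j * K n k * conj (y l m n) := by
  have hsum : cubeNorm K y = ∑ q : ι × ι × ι, ∑ p : ι × ι × ι,
      y q.1 q.2.1 q.2.2 * K p.1 q.1 * K p.2.1 q.2.1 * K p.2.2 q.2.2 *
        conj (y p.1 p.2.1 p.2.2) := by
    rw [Finset.sum_comm]
    simp only [cubeNorm, dotProduct, mulVec, Finset.mul_sum]
    refine Finset.sum_congr rfl fun p _ => Finset.sum_congr rfl fun q _ => ?_
    simp only [cubeVec, cubeMat, kroneckerMap_apply, Pi.star_apply, RCLike.star_def]
    ring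
  rw [hsum]
  simp only [Fintype.sum_prod_type]

lemma sum_contraction_eq_cubeNorm (K : Matrix ι ι ℂ) (y : ι → ι → ι → ℂ) :
    ∑ k, ∑ l, K l k * ∑ i, ∑ j, K j i * ∑ n, ∑ m, K n m * y k i m * conj (y l j n) =
      cubeNorm K y := by
  simp only [cubeNorm_eq_sum, Finset.mul_sum]
  refine Finset.sum_congr rfl fun k _ => Finset.sum_comm.trans (Finset.sum_congr rfl fun i _ => ?_)
  rw [Finset.sum_congr rfl fun l _ => Finset.sum_comm_cycle, Finset.sum_comm]
  refine Finset.sum_congr rfl fun m _ => Finset.sum_congr rfl fun l _ =>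
    Finset.sum_congr rfl fun j _ => Finset.sum_congr rfl fun n _ => by ring

lemma star_mulVec_dotProduct_mulVec (A : Matrix κ ι ℂ) (K : Matrix κ κ ℂ) (v : ι → ℂ) :
    star (A *ᵥ v) ⬝ᵥ (K *ᵥ (A *ᵥ v)) = star v ⬝ᵥ ((Aᴴ * K * A) *ᵥ v) := by
  rw [star_mulVec, ← dotProduct_mulVec, mulVec_mulVec, mulVec_mulVec, Matrix.mul_assoc]

lemma cubeNorm_cubePull (J : Matrix κ ι ℂ) (K : Matrix ι ι ℂ) (y : κ → κ → κ → ℂ) :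
    cubeNorm K (cubePull J y) = cubeNorm (Jᵀᴴ * K * Jᵀ) y := by
  rw [cubeNorm, cubeVec_cubePull, star_mulVec_dotProduct_mulVec, ← cubeMat_conjTranspose,
    ← cubeMat_mul, ← cubeMat_mul, cubeNorm]

lemma cubeNorm_gram (A : Matrix κ ι ℂ) (y : ι → ι → ι → ℂ) :
    cubeNorm (Aᴴ * A) y = ((∑ p, Complex.normSq ((cubeMat A *ᵥ cubeVec y) p) : ℝ) : ℂ) := by
  classical
  have h := star_mulVec_dotProduct_mulVec (cubeMat A) 1 (cubeVec y)
  rw [one_mulVec, Matrix.mul_one, ← cubeMat_conjTranspose, ← cubeMat_mul] at h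
  rw [cubeNorm, ← h, dotProduct, Complex.ofReal_sum]
  exact Finset.sum_congr rfl fun p _ => (Complex.normSq_eq_conj_mul_self).symm

lemma cubeNorm_nonneg {K : Matrix ι ι ℂ} (hK : 0 ≤ K) (y : ι → ι → ι → ℂ) : 0 ≤ cubeNorm K y := by
  rw [nonneg_iff_posSemidef] at hK
  exact (hK.kronecker (hK.kronecker hK)).dotProduct_mulVec_nonneg _

lemma eq_zero_of_cubeNorm_eq_zero {K : Matrix ι ι ℂ} (hK : K.PosDef) {y : ι → ι → ι → ℂ}
    (h : cubeNorm K y = 0) (i j k : ι) : y i j k = 0 := by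
  by_contra hne
  have hy : cubeVec y ≠ 0 := fun h0 => hne (congrFun h0 (i, j, k))
  exact ((hK.kronecker (hK.kronecker hK)).dotProduct_mulVec_pos hy).ne' h

lemma cubeNorm_mono {K L : Matrix ι ι ℂ} (hL : 0 ≤ L) (hLK : L ≤ K) (y : ι → ι → ι → ℂ) :
    cubeNorm L y ≤ cubeNorm K y := by
  have h := (le_iff.1 (cubeMat_mono hL hLK)).dotProduct_mulVec_nonneg (cubeVec y)
  rwa [sub_mulVec, dotProduct_sub, sub_nonneg] at h

end CubicForms

section MatrixInverse

variable {n : Type*} [Fintype n] [DecidableEq n]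

lemma inv_le_inv_of_posDef {H P : Matrix n n ℂ} (hH : H.PosDef) (hHP : H ≤ P) : P⁻¹ ≤ H⁻¹ := by
  open scoped Matrix.Norms.L2Operator in
  simpa only [nonsing_inv_eq_ringInverse] using
    CStarAlgebra.ringInverse_le_ringInverse hHP hH.isStrictlyPositive

lemma contDiffAt_matrix_inv {𝕜 E : Type*} [NontriviallyNormedField 𝕜] [NormedAlgebra 𝕜 ℂ]
    [NormedAddCommGroup E] [NormedSpace 𝕜 E] {m : WithTop ℕ∞} {A : E → Matrix n n ℂ} {z : E}
    (hA : ∀ i j, ContDiffAt 𝕜 m (A · i j) z) (hdet : IsUnit (A z).det) (i j : n) :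
    ContDiffAt 𝕜 m (fun w => (A w)⁻¹ i j) z := by
  open scoped Matrix.Norms.Operator in
  have hentry : ∀ X : Matrix n n ℂ, ContDiffAt 𝕜 m (fun B : Matrix n n ℂ => B i j) X := fun X =>
    ((entryLinearMap ℂ ℂ i j).toContinuousLinearMap.restrictScalars 𝕜).contDiff.contDiffAt
  have hAmat : ContDiffAt 𝕜 m A z := by
    have hsum : A = fun w => ∑ i, ∑ j, A w i j • single i j (1 : ℂ) := by
      funext w
      simpa using matrix_eq_sum_single (A w)
    rw [hsum]
    exact ContDiffAt.sum fun i _ => ContDiffAt.sum fun j _ => (hA i j).smul contDiffAt_const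
  have hinv : ContDiffAt 𝕜 m Ring.inverse (A z) := by
    rw [← isUnit_iff_isUnit_det] at hdet
    exact contDiffAt_ringInverse 𝕜 hdet.unit
  simp only [nonsing_inv_eq_ringInverse]
  exact (hentry _).comp z (hinv.comp z hAmat)

end MatrixInverse

section LeviForm

variable {r : ℕ} {f g : Cn r → ℂ} {h k : Cn r → ℝ} {z : Cn r}

/-- The Levi form `∂_i ∂_{j̄} f v^i v̄^j` of `f` at `z`. -/
def levi (f : Cn r → ℂ) (z v : Cn r) : ℂ :=
  ∑ i, ∑ j, dz i (dzbar j f) z * v i * conj (v j)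

lemma apply_eq_sum_re_im (φ : Cn r →L[ℝ] ℂ) (v : Cn r) :
    φ v = ∑ i, ((v i).re * φ (Pi.single i 1) + (v i).im * φ (Pi.single i Complex.I)) := by
  have hv : v = ∑ i, ((v i).re • (Pi.single i 1 : Cn r) +
      (v i).im • (Pi.single i Complex.I : Cn r)) := by
    conv_lhs => rw [← Finset.univ_sum_single v]
    refine Finset.sum_congr rfl fun i _ => ?_
    rw [← Pi.single_smul, ← Pi.single_smul, ← Pi.single_add]
    congr 1
    simp [Complex.re_add_im]
  conv_lhs => rw [hv]
  simp only [map_sum, map_add, map_smul, Complex.real_smul]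

lemma sum_del_mul (φ : Cn r →L[ℝ] ℂ) (v : Cn r) :
    ∑ i, del i φ * v i = (φ v - Complex.I * φ (Complex.I • v)) / 2 := by
  rw [apply_eq_sum_re_im φ v, apply_eq_sum_re_im φ (Complex.I • v), Finset.mul_sum,
    ← Finset.sum_sub_distrib, Finset.sum_div]
  refine Finset.sum_congr rfl fun i _ => ?_
  have hdel : del i φ = (φ (Pi.single i 1) - Complex.I * φ (Pi.single i Complex.I)) / 2 := rfl
  conv_lhs => rw [hdel, ← Complex.re_add_im (v i)]
  simp only [Pi.smul_apply, smul_eq_mul, Complex.I_mul_re, Complex.I_mul_im, Complex.ofReal_neg]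
  linear_combination (-(v i).im * φ (Pi.single i Complex.I) / 2) * Complex.I_sq

lemma sum_delbar_mul_conj (φ : Cn r →L[ℝ] ℂ) (v : Cn r) :
    ∑ i, delbar i φ * conj (v i) = (φ v + Complex.I * φ (Complex.I • v)) / 2 := by
  rw [apply_eq_sum_re_im φ v, apply_eq_sum_re_im φ (Complex.I • v), Finset.mul_sum,
    ← Finset.sum_add_distrib, Finset.sum_div]
  refine Finset.sum_congr rfl fun i _ => ?_
  have hdelbar : delbar i φ = (φ (Pi.single i 1) + Complex.I * φ (Pi.single i Complex.I)) / 2 := rfl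
  have hconj : conj (v i) = (v i).re - (v i).im * Complex.I := by apply Complex.ext <;> simp
  rw [hdelbar, hconj]
  simp only [Pi.smul_apply, smul_eq_mul, Complex.I_mul_re, Complex.I_mul_im, Complex.ofReal_neg]
  linear_combination (-(v i).im * φ (Pi.single i Complex.I) / 2) * Complex.I_sq

lemma differentiableAt_fderiv {F : Type*} [NormedAddCommGroup F] [NormedSpace ℝ F] {f : Cn r → F}
    (hf : ContDiffAt ℝ 2 f z) : DifferentiableAt ℝ (fderiv ℝ f) z :=
  (hf.fderiv_right (m := 1) (by norm_num)).differentiableAt one_ne_zero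

lemma dz_dzbar_eq (hf : ContDiffAt ℝ 2 f z) (i j : Fin r) :
    dz i (dzbar j f) z = del i
      (((delbar j).restrictScalars ℝ).toContinuousLinearMap ∘L fderiv ℝ (fderiv ℝ f) z) := by
  have h := ((delbar j).restrictScalars ℝ).toContinuousLinearMap.hasFDerivAt.comp z
    (differentiableAt_fderiv hf).hasFDerivAt
  exact congrArg (del i) h.fderiv

lemma levi_eq_fderiv_fderiv (hf : ContDiffAt ℝ 2 f z) (v : Cn r) :
    levi f z v = (fderiv ℝ (fderiv ℝ f) z v v +
      fderiv ℝ (fderiv ℝ f) z (Complex.I • v) (Complex.I • v)) / 4 := by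
  have hsymm := hf.isSymmSndFDerivAt (by simp) v (Complex.I • v)
  simp only [levi, dz_dzbar_eq hf]
  set D := fderiv ℝ (fderiv ℝ f) z
  rw [Finset.sum_comm]
  simp only [← Finset.sum_mul, sum_del_mul]
  have happly : ∀ j u, (((delbar j).restrictScalars ℝ).toContinuousLinearMap ∘L D) u =
    delbar j (D u) := fun j u => rfl
  have hterm : ∀ j, (delbar j (D v) - Complex.I * delbar j (D (Complex.I • v))) / 2 * conj (v j) =
      (delbar j (D v) * conj (v j) -
        Complex.I * (delbar j (D (Complex.I • v)) * conj (v j))) / 2 := fun j => by ring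
  simp only [happly, hterm]
  rw [← Finset.sum_div, Finset.sum_sub_distrib, ← Finset.mul_sum, sum_delbar_mul_conj,
    sum_delbar_mul_conj, hsymm]
  linear_combination (-(1 / 4) * D (Complex.I • v) (Complex.I • v)) * Complex.I_sq

lemma fderiv_fderiv_ofReal (hh : ContDiffAt ℝ 2 h z) (u v : Cn r) :
    fderiv ℝ (fderiv ℝ fun w => (h w : ℂ)) z u v = (fderiv ℝ (fderiv ℝ h) z u v : ℝ) := by
  have hfderiv : fderiv ℝ (fun w => (h w : ℂ)) =ᶠ[𝓝 z]
      fun w => Complex.ofRealCLM ∘L fderiv ℝ h w :=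
    (hh.eventually (by simp)).mono fun w hw =>
      (Complex.ofRealCLM.hasFDerivAt.comp w (hw.differentiableAt two_ne_zero).hasFDerivAt).fderiv
  have hsnd := (hasFDerivAt_const Complex.ofRealCLM z).clm_comp
    (differentiableAt_fderiv hh).hasFDerivAt
  rw [hfderiv.fderiv_eq, hsnd.fderiv]
  simp

lemma fderiv_fderiv_sub (hh : ContDiffAt ℝ 2 h z) (hk : ContDiffAt ℝ 2 k z) :
    fderiv ℝ (fderiv ℝ fun w => h w - k w) z =
      fderiv ℝ (fderiv ℝ h) z - fderiv ℝ (fderiv ℝ k) z := by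
  have hfderiv : fderiv ℝ (fun w => h w - k w) =ᶠ[𝓝 z] fun w => fderiv ℝ h w - fderiv ℝ k w :=
    ((hh.eventually (by simp)).and (hk.eventually (by simp))).mono fun w hw =>
      fderiv_fun_sub (hw.1.differentiableAt two_ne_zero) (hw.2.differentiableAt two_ne_zero)
  rw [hfderiv.fderiv_eq, fderiv_fun_sub (differentiableAt_fderiv hh) (differentiableAt_fderiv hk)]

lemma deriv_deriv_nonneg_of_isLocalMin {φ : ℝ → ℝ} {t : ℝ} (hφ : ContinuousAt φ t)
    (hmin : IsLocalMin φ t) : 0 ≤ deriv (deriv φ) t := by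
  by_contra hneg
  rw [not_le] at hneg
  have hmax := isLocalMax_of_deriv_deriv_neg hneg hmin.deriv_eq_zero hφ
  have hconst : φ =ᶠ[𝓝 t] fun _ => φ t := hmin.mp (hmax.mono fun s h1 h2 => le_antisymm h1 h2)
  rw [hconst.deriv.deriv_eq] at hneg
  simp at hneg

lemma fderiv_fderiv_nonneg_of_isLocalMin (hh : ContDiffAt ℝ 2 h z) (hmin : IsLocalMin h z)
    (u : Cn r) : 0 ≤ fderiv ℝ (fderiv ℝ h) z u u := by
  let line : ℝ → Cn r := fun t => z + t • u
  have hline : ∀ t, HasDerivAt line u t := fun t => by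
    simpa [line] using ((hasDerivAt_id t).smul_const u).const_add z
  have hz : line 0 = z := by simp [line]
  have htendsto : Filter.Tendsto line (𝓝 0) (𝓝 z) := hz ▸ (hline 0).continuousAt.tendsto
  have hderiv : deriv (h ∘ line) =ᶠ[𝓝 0] fun t => fderiv ℝ h (line t) u :=
    (htendsto.eventually (hh.eventually (by simp))).mono fun t ht =>
      ((ht.differentiableAt two_ne_zero).hasFDerivAt.comp_hasDerivAt t (hline t)).deriv
  have hderiv2 : deriv (deriv (h ∘ line)) 0 = fderiv ℝ (fderiv ℝ h) z u u := by
    rw [hderiv.deriv_eq]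
    have hclm := ((hz.symm ▸ differentiableAt_fderiv hh :
      DifferentiableAt ℝ (fderiv ℝ h) (line 0)).hasFDerivAt.comp_hasDerivAt 0 (hline 0)).clm_apply
        (hasDerivAt_const 0 u)
    simpa [hz] using hclm.deriv
  rw [← hderiv2]
  refine deriv_deriv_nonneg_of_isLocalMin
    ((hz.symm ▸ hh.continuousAt : ContinuousAt h (line 0)).comp (hline 0).continuousAt) ?_
  exact (htendsto.eventually hmin).mono fun t ht => by simpa [hz] using ht

lemma levi_le_levi_of_le_of_eq (hh : ContDiffAt ℝ 2 h z) (hk : ContDiffAt ℝ 2 k z)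
    (hle : ∀ᶠ w in 𝓝 z, h w ≤ k w) (heq : h z = k z) (v : Cn r) :
    levi (fun w => (h w : ℂ)) z v ≤ levi (fun w => (k w : ℂ)) z v := by
  have hmin : IsLocalMin (fun w => k w - h w) z := hle.mono fun w hw => by
    simpa [heq] using hw
  have hnonneg := fun u => fderiv_fderiv_nonneg_of_isLocalMin (hk.sub hh) hmin u
  simp only [fderiv_fderiv_sub hk hh, _root_.sub_apply, sub_nonneg] at hnonneg
  have hhℂ : ContDiffAt ℝ 2 (fun w => (h w : ℂ)) z :=
    Complex.ofRealCLM.contDiff.contDiffAt.comp z hh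
  have hkℂ : ContDiffAt ℝ 2 (fun w => (k w : ℂ)) z :=
    Complex.ofRealCLM.contDiff.contDiffAt.comp z hk
  simp only [levi_eq_fderiv_fderiv hhℂ, levi_eq_fderiv_fderiv hkℂ, fderiv_fderiv_ofReal hh,
    fderiv_fderiv_ofReal hk]
  have hreal := div_le_div_of_nonneg_right (add_le_add (hnonneg v) (hnonneg (Complex.I • v)))
    (by norm_num : (0 : ℝ) ≤ 4)
  exact_mod_cast hreal

lemma matDeriv_delbar_mul_conjTranspose {m n : Type*} [Fintype n] {A : Cn r → Matrix m n ℂ}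
    (hA : ∀ i j, DifferentiableAt ℂ (A · i j) z) (l : Fin r) :
    matDeriv (delbar l) (fun w => A w * (A w)ᴴ) z = A z * (matDeriv (del l) A z)ᴴ := by
  have hAℝ : ∀ i j, DifferentiableAt ℝ (A · i j) z := fun i j => (hA i j).restrictScalars ℝ
  rw [matDeriv_mul hAℝ (differentiableAt_conjTranspose hAℝ), matDeriv_delbar_eq_zero hA,
    matDeriv_delbar_conjTranspose, Matrix.zero_mul, zero_add]

lemma matDeriv_del_delbar_mul_conjTranspose {m n : Type*} [Finite m] [Fintype n]
    {A : Cn r → Matrix m n ℂ} (hA : ∀ i j, ContDiffAt ℂ ∞ (A · i j) z) (k l : Fin r) :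
    matDeriv (del k) (matDeriv (delbar l) fun w => A w * (A w)ᴴ) z =
      matDeriv (del k) A z * (matDeriv (del l) A z)ᴴ := by
  have hAℂ := eventually_forall_differentiableAt hA
  have hA' := differentiableAt_matDeriv_del hA l
  rw [matDeriv_congr (hAℂ.mono fun w hw => matDeriv_delbar_mul_conjTranspose hw l),
    matDeriv_mul (fun i j => (hAℂ.self_of_nhds i j).restrictScalars ℝ)
      (differentiableAt_conjTranspose fun i j => (hA' i j).restrictScalars ℝ),
    matDeriv_del_conjTranspose_eq_zero hA', Matrix.mul_zero, add_zero]

lemma levi_sum_normSq_nonneg {ι : Type*} [Fintype ι] {q : ι → Cn r → ℂ}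
    (hq : ∀ p, ContDiffAt ℂ ∞ (q p) z) (v : Cn r) :
    0 ≤ levi (fun w => ((∑ p, Complex.normSq (q p w) : ℝ) : ℂ)) z v := by
  let A : Cn r → Matrix Unit ι ℂ := fun w => Matrix.of fun _ p => q p w
  have hA : ∀ i j, ContDiffAt ℂ ∞ (A · i j) z := fun _ p => hq p
  have hgram : (fun w => ((∑ p, Complex.normSq (q p w) : ℝ) : ℂ)) =
      fun w => (A w * (A w)ᴴ) () () := by
    funext w
    simp [A, Matrix.mul_apply, Complex.mul_conj]
  have hlevi : levi (fun w => ((∑ p, Complex.normSq (q p w) : ℝ) : ℂ)) z v =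
      ∑ p, (Complex.normSq (∑ i, v i * matDeriv (del i) A z () p) : ℂ) := by
    have hdz : ∀ i j, dz i (dzbar j fun w => (A w * (A w)ᴴ) () ()) z =
        (matDeriv (del i) A z * (matDeriv (del j) A z)ᴴ) () () := fun i j =>
      congrFun₂ (matDeriv_del_delbar_mul_conjTranspose hA i j) () ()
    simp only [levi, hgram, hdz]
    simp only [Matrix.mul_apply, conjTranspose_apply, RCLike.star_def, ← Complex.mul_conj,
      map_sum, map_mul, Finset.sum_mul]
    rw [Finset.sum_comm_cycle]
    simp only [Finset.mul_sum]
    exact Finset.sum_congr rfl fun p _ => Finset.sum_congr rfl fun i _ =>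
      Finset.sum_congr rfl fun j _ => by ring
  rw [hlevi]
  exact Finset.sum_nonneg fun p _ => by exact_mod_cast Complex.normSq_nonneg _

end LeviForm

section CubeNormLevi

variable {r : ℕ} {n : Type*} [Fintype n] {z : Cn r} {y : Cn r → n → n → n → ℂ}

lemma contDiffAt_cubeNorm {K : Cn r → Matrix n n ℂ} (hK : ∀ i j, ContDiffAt ℝ ∞ (K · i j) z)
    (hy : ∀ i j k, ContDiffAt ℝ ∞ (y · i j k) z) :
    ContDiffAt ℝ ∞ (fun w => cubeNorm (K w) (y w)) z := by
  simp only [cubeNorm_eq_sum]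
  exact ContDiffAt.sum fun i _ => ContDiffAt.sum fun j _ => ContDiffAt.sum fun k _ =>
    ContDiffAt.sum fun l _ => ContDiffAt.sum fun m _ => ContDiffAt.sum fun n _ =>
      ((((hy i j k).mul (hK l i)).mul (hK m j)).mul (hK n k)).mul
        (Complex.conjCLE.contDiff.contDiffAt.comp z (hy l m n))

lemma contDiffAt_cubeMat_mulVec {A : Cn r → Matrix n n ℂ}
    (hA : ∀ i j, ContDiffAt ℂ ∞ (A · i j) z) (hy : ∀ i j k, ContDiffAt ℂ ∞ (y · i j k) z)
    (p : n × n × n) : ContDiffAt ℂ ∞ (fun w => (cubeMat (A w) *ᵥ cubeVec (y w)) p) z :=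
  ContDiffAt.sum fun _ _ => ((hA _ _).mul ((hA _ _).mul (hA _ _))).mul (hy _ _ _)

lemma contDiffAt_normSq {q : Cn r → ℂ} (hq : ContDiffAt ℂ ∞ q z) :
    ContDiffAt ℝ ∞ (fun w => Complex.normSq (q w)) z := by
  have hqℝ := hq.restrict_scalars ℝ
  simp only [Complex.normSq_apply]
  exact ((Complex.reCLM.contDiff.contDiffAt.comp z hqℝ).mul
    (Complex.reCLM.contDiff.contDiffAt.comp z hqℝ)).add
      ((Complex.imCLM.contDiff.contDiffAt.comp z hqℝ).mul
        (Complex.imCLM.contDiff.contDiffAt.comp z hqℝ))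

variable [DecidableEq n]

lemma twoIm_le_of_posDef (T : Matrix n n ℂ) {T₀ : Matrix n n ℂ} (hT₀ : (twoIm T₀).PosDef) :
    twoIm T ≤ ((-Complex.I) • (T - T₀ᴴ)) * (twoIm T₀)⁻¹ * ((-Complex.I) • (T - T₀ᴴ))ᴴ := by
  have hu := (isUnit_iff_isUnit_det _).1 hT₀.isUnit
  set D := (-Complex.I) • (T - T₀)
  have hQ : (-Complex.I) • (T - T₀ᴴ) = twoIm T₀ + D := by
    simp only [twoIm, D, smul_sub]
    module
  have hT : twoIm T = twoIm T₀ + D + Dᴴ := by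
    simp only [twoIm, D, conjTranspose_smul, conjTranspose_sub, star_neg, RCLike.star_def,
      Complex.conj_I, neg_neg, smul_sub]
    module
  have hdiff : (twoIm T₀ + D) * (twoIm T₀)⁻¹ * (twoIm T₀ + D)ᴴ - twoIm T =
      D * (twoIm T₀)⁻¹ * Dᴴ := by
    rw [hT, conjTranspose_add, hT₀.isHermitian.eq, Matrix.add_mul, mul_nonsing_inv _ hu,
      Matrix.mul_add, Matrix.add_mul, Matrix.add_mul, nonsing_inv_mul_cancel_right _ _ hu]
    noncomm_ring
  rw [hQ, le_iff, hdiff]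
  exact hT₀.inv.posSemidef.mul_mul_conjTranspose_same _

lemma exists_holomorphic_gram_le_inv_twoIm {T : Cn r → Matrix n n ℂ}
    (hT : ∀ i j, ContDiffAt ℂ ∞ (T · i j) z) (hH : (twoIm (T z)).PosDef) :
    ∃ A : Cn r → Matrix n n ℂ, (∀ i j, ContDiffAt ℂ ∞ (A · i j) z) ∧
      (A z)ᴴ * A z = (twoIm (T z))⁻¹ ∧
      ∀ w, (twoIm (T w)).PosDef → (A w)ᴴ * A w ≤ (twoIm (T w))⁻¹ := by
  obtain ⟨B, hB⟩ := CStarAlgebra.nonneg_iff_eq_star_mul_self.1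
    (nonneg_iff_posSemidef.2 hH.posSemidef)
  have hu := (isUnit_iff_isUnit_det _).1 hH.isUnit
  let Q : Cn r → Matrix n n ℂ := fun w => (-Complex.I) • (T w - (T z)ᴴ)
  have hQz : Q z = twoIm (T z) := by
    simp only [Q, twoIm, smul_sub]
    module
  have hQ : ∀ i j, ContDiffAt ℂ ∞ (Q · i j) z := fun i j =>
    contDiffAt_const.mul ((hT i j).sub contDiffAt_const)
  have hgram : ∀ w, (B * (Q w)⁻¹)ᴴ * (B * (Q w)⁻¹) = (Q w * (twoIm (T z))⁻¹ * (Q w)ᴴ)⁻¹ := by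
    intro w
    rw [Matrix.mul_inv_rev, Matrix.mul_inv_rev, nonsing_inv_nonsing_inv _ hu, hB,
      conjTranspose_mul, conjTranspose_nonsing_inv, star_eq_conjTranspose]
    simp only [Matrix.mul_assoc]
  refine ⟨fun w => B * (Q w)⁻¹, fun i j => ?_, ?_, fun w hw => ?_⟩
  · exact ContDiffAt.sum fun l _ => contDiffAt_const.mul
      (contDiffAt_matrix_inv hQ (hQz.symm ▸ hu) l j)
  · rw [hgram, hQz, hH.isHermitian.eq, mul_nonsing_inv _ hu, Matrix.one_mul]
  · rw [hgram]
    exact inv_le_inv_of_posDef hw (twoIm_le_of_posDef (T w) hH)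

variable {T : Cn r → Matrix n n ℂ}

lemma contDiffAt_cubeNorm_inv_twoIm (hT : ∀ i j, ContDiffAt ℂ ∞ (T · i j) z)
    (hH : (twoIm (T z)).PosDef) (hy : ∀ i j k, ContDiffAt ℂ ∞ (y · i j k) z) :
    ContDiffAt ℝ ∞ (fun w => cubeNorm (twoIm (T w))⁻¹ (y w)) z :=
  contDiffAt_cubeNorm (contDiffAt_matrix_inv (contDiffAt_twoIm hT)
    ((isUnit_iff_isUnit_det _).1 hH.isUnit)) fun i j k => (hy i j k).restrict_scalars ℝ

lemma contDiffAt_of_eventually_eq_cubeNorm_inv_twoIm {f : Cn r → ℝ}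
    (hT : ∀ i j, ContDiffAt ℂ ∞ (T · i j) z) (hH : (twoIm (T z)).PosDef)
    (hy : ∀ i j k, ContDiffAt ℂ ∞ (y · i j k) z)
    (hf : ∀ᶠ w in 𝓝 z, (f w : ℂ) = cubeNorm (twoIm (T w))⁻¹ (y w)) : ContDiffAt ℝ ∞ f z :=
  Complex.reCLM.contDiff.contDiffAt.comp z
    ((contDiffAt_cubeNorm_inv_twoIm hT hH hy).congr_of_eventuallyEq hf)

lemma levi_cubeNorm_inv_twoIm_nonneg {f : Cn r → ℝ} (hT : ∀ i j, ContDiffAt ℂ ∞ (T · i j) z)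
    (hH : ∀ᶠ w in 𝓝 z, (twoIm (T w)).PosDef) (hy : ∀ i j k, ContDiffAt ℂ ∞ (y · i j k) z)
    (hf : ∀ᶠ w in 𝓝 z, (f w : ℂ) = cubeNorm (twoIm (T w))⁻¹ (y w)) (v : Cn r) :
    0 ≤ levi (fun w => (f w : ℂ)) z v := by
  obtain ⟨A, hA, hAz, hAle⟩ := exists_holomorphic_gram_le_inv_twoIm hT hH.self_of_nhds
  let q : n × n × n → Cn r → ℂ := fun p w => (cubeMat (A w) *ᵥ cubeVec (y w)) p
  have hq : ∀ p, ContDiffAt ℂ ∞ (q p) z := contDiffAt_cubeMat_mulVec hA hy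
  have hle : ∀ᶠ w in 𝓝 z, ∑ p, Complex.normSq (q p w) ≤ f w := by
    filter_upwards [hf, hH] with w hfw hHw
    have hmono := cubeNorm_mono (posSemidef_conjTranspose_mul_self (A w)).nonneg (hAle w hHw) (y w)
    rwa [cubeNorm_gram, ← hfw, Complex.real_le_real] at hmono
  have heq : ∑ p, Complex.normSq (q p z) = f z := by
    rw [← Complex.ofReal_inj, hf.self_of_nhds, ← hAz, cubeNorm_gram]
  exact (levi_sum_normSq_nonneg hq v).trans (levi_le_levi_of_le_of_eq
    ((ContDiffAt.sum fun p _ => contDiffAt_normSq (hq p)).of_le ENat.LEInfty.out)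
    ((contDiffAt_of_eventually_eq_cubeNorm_inv_twoIm hT hH.self_of_nhds hy hf).of_le
      ENat.LEInfty.out) hle heq v)

end CubeNormLevi

section Jacobian

variable {r s t : ℕ}

/-- The Jacobian matrix `∂φ^a / ∂z^i`. -/
def jacobian (φ : Cn s → Cn r) (z : Cn s) : Matrix (Fin r) (Fin s) ℂ :=
  Matrix.of fun a i => holPartial i (fun w => φ w a) z

lemma fderiv_single_apply {φ : Cn s → Cn r} {z : Cn s} (hφ : DifferentiableAt ℂ φ z)
    (a : Fin r) (i : Fin s) : fderiv ℂ φ z (Pi.single i 1) a = jacobian φ z a i := by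
  rw [jacobian, Matrix.of_apply, holPartial, fderiv_apply hφ]
  rfl

lemma contDiffAt_jacobian {φ : Cn s → Cn r} {z : Cn s} (hφ : ContDiffAt ℂ ∞ φ z) (a : Fin r)
    (i : Fin s) : ContDiffAt ℂ ∞ (jacobian φ · a i) z :=
  contDiffAt_holPartial (contDiffAt_pi.1 hφ a) i

lemma jacobian_congr {φ ψ : Cn s → Cn r} {z : Cn s} (h : φ =ᶠ[𝓝 z] ψ) :
    jacobian φ z = jacobian ψ z := by
  ext a i
  exact holPartial_congr (h.mono fun w hw => congrFun hw a) i

lemma jacobian_comp {φ : Cn s → Cn r} {ψ : Cn r → Cn t} {z : Cn s}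
    (hψ : DifferentiableAt ℂ ψ (φ z)) (hφ : DifferentiableAt ℂ φ z) :
    jacobian (fun w => ψ (φ w)) z = jacobian ψ (φ z) * jacobian φ z := by
  ext a i
  exact holPartial_comp (differentiableAt_pi.1 hψ a) hφ i

lemma jacobian_id (z : Cn r) : jacobian (fun w => w) z = 1 := by
  ext a i
  rw [← fderiv_single_apply differentiableAt_fun_id, fderiv_fun_id]
  simp [Matrix.one_apply, Pi.single_apply]

lemma jacobian_affine {f : Cn r → Cn s} {z : Cn r} (hf : DifferentiableAt ℂ f z)
    (A : Matrix (Fin t) (Fin s) ℂ) (B : Matrix (Fin t) (Fin r) ℂ) (c : Cn t) :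
    jacobian (fun w => A *ᵥ f w + B *ᵥ w + c) z = A * jacobian f z + B := by
  have hA : HasFDerivAt (A *ᵥ f ·) _ z :=
    (mulVecLin A).toContinuousLinearMap.hasFDerivAt.comp z hf.hasFDerivAt
  have hB : HasFDerivAt (B *ᵥ ·) _ z := (mulVecLin B).toContinuousLinearMap.hasFDerivAt
  have hsum : HasFDerivAt (fun w => A *ᵥ f w + B *ᵥ w + c) _ z := (hA.add hB).add_const c
  ext a i
  rw [← fderiv_single_apply hsum.differentiableAt, hsum.fderiv]
  simp [Matrix.mul_apply, mulVec, dotProduct, fderiv_single_apply hf]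

end Jacobian

section Prepotential

variable {r s : ℕ} {F : Cn r → ℂ} {a : Cn r}

/-- The vector of holomorphic partial derivatives `∂F / ∂a^i`. -/
def grad (F : Cn r → ℂ) (a : Cn r) : Cn r := fun i => holPartial i F a

/-- The complex Hessian matrix `∂² F / ∂a^i ∂a^j`. -/
def hess (F : Cn r → ℂ) (a : Cn r) : Matrix (Fin r) (Fin r) ℂ :=
  Matrix.of fun i j => holPartial i (holPartial j F) a

/-- The cubic form of third derivatives `∂³ F / ∂a^i ∂a^j ∂a^k`. -/
def thirdPartial (F : Cn r → ℂ) (a : Cn r) (i j k : Fin r) : ℂ :=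
  holPartial i (holPartial j (holPartial k F)) a

lemma contDiffAt_grad (hF : ContDiffAt ℂ ∞ F a) : ContDiffAt ℂ ∞ (grad F) a :=
  contDiffAt_pi.2 (contDiffAt_holPartial hF)

lemma contDiffAt_hess (hF : ContDiffAt ℂ ∞ F a) (i j : Fin r) :
    ContDiffAt ℂ ∞ (hess F · i j) a :=
  contDiffAt_holPartial (contDiffAt_holPartial hF j) i

lemma contDiffAt_thirdPartial (hF : ContDiffAt ℂ ∞ F a) (i j k : Fin r) :
    ContDiffAt ℂ ∞ (thirdPartial F · i j k) a :=
  contDiffAt_holPartial (contDiffAt_hess hF j k) i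

lemma hess_isSymm (hF : ContDiffAt ℂ 2 F a) : (hess F a).IsSymm := by
  ext i j
  exact holPartial_comm hF j i

lemma thirdPartial_swap_left (hF : ContDiffAt ℂ ∞ F a) (i j k : Fin r) :
    thirdPartial F a i j k = thirdPartial F a j i k :=
  holPartial_comm ((contDiffAt_holPartial hF k).of_le ENat.LEInfty.out) i j

lemma thirdPartial_swap_right (hF : ContDiffAt ℂ ∞ F a) (i j k : Fin r) :
    thirdPartial F a i j k = thirdPartial F a i k j :=
  holPartial_congr ((eventually_contDiffAt_infty (hF.of_le ENat.LEInfty.out)).mono fun _ h =>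
    holPartial_comm (h.of_le ENat.LEInfty.out) j k) i

lemma jacobian_grad (hF : ContDiffAt ℂ 2 F a) : jacobian (grad F) a = hess F a := by
  ext i j
  exact holPartial_comm hF j i

lemma jacobian_eventuallyEq_of_affine_grad (hF : ContDiffAt ℂ ∞ F a) {f : Cn r → Cn s}
    {A B : Matrix (Fin s) (Fin r) ℂ} {c : Cn s}
    (hf : f =ᶠ[𝓝 a] fun w => A *ᵥ grad F w + B *ᵥ w + c) :
    jacobian f =ᶠ[𝓝 a] fun w => A * hess F w + B := by
  filter_upwards [hf.eventuallyEq_nhds, eventually_contDiffAt_infty (hF.of_le ENat.LEInfty.out)]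
    with w hw hFw
  rw [jacobian_congr hw, jacobian_affine ((contDiffAt_grad hFw).differentiableAt (by simp)),
    jacobian_grad (hFw.of_le ENat.LEInfty.out)]

lemma contDiffAt_hess_comp {φ : Cn s → Cn r} {z : Cn s} (hF : ContDiffAt ℂ ∞ F (φ z))
    (hφ : ContDiffAt ℂ ∞ φ z) (i j : Fin r) : ContDiffAt ℂ ∞ (fun w => hess F (φ w) i j) z :=
  (contDiffAt_hess hF i j).comp z hφ

lemma matDeriv_del_hess_comp {φ : Cn s → Cn r} {z : Cn s} (hF : ContDiffAt ℂ ∞ F (φ z))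
    (hφ : ContDiffAt ℂ ∞ φ z) (k : Fin s) :
    matDeriv (del k) (fun w => hess F (φ w)) z =
      Matrix.of fun i j => ∑ c, thirdPartial F (φ z) c i j * jacobian φ z c k := by
  ext i j
  rw [matDeriv_del, dz_eq_holPartial ((contDiffAt_hess_comp hF hφ i j).differentiableAt (by simp))]
  exact holPartial_comp ((contDiffAt_hess hF i j).differentiableAt (by simp))
    (hφ.differentiableAt (by simp)) k

lemma transpose_mul_mul_apply_eq_cubePull (J : Matrix (Fin r) (Fin s) ℂ)
    (y : Fin r → Fin r → Fin r → ℂ) (i j k : Fin s) :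
    (Jᵀ * (Matrix.of fun p q => ∑ c, y c p q * J c i) * J) j k = cubePull J y i j k := by
  simp only [Matrix.mul_apply, Matrix.of_apply, transpose_apply, cubePull, Finset.sum_mul,
    Finset.mul_sum]
  rw [Finset.sum_comm_cycle]
  refine Finset.sum_congr rfl fun a _ => Finset.sum_comm.trans ?_
  exact Finset.sum_congr rfl fun b _ => Finset.sum_congr rfl fun c _ => by ring

lemma transpose_mul_matDeriv_del_hess_comp_mul {φ : Cn s → Cn r} {z : Cn s}
    (hF : ContDiffAt ℂ ∞ F (φ z)) (hφ : ContDiffAt ℂ ∞ φ z) (k : Fin s) :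
    (jacobian φ z)ᵀ * matDeriv (del k) (fun w => hess F (φ w)) z * jacobian φ z =
      Matrix.of (cubePull (jacobian φ z) (thirdPartial F (φ z)) k) := by
  rw [matDeriv_del_hess_comp hF hφ]
  ext i j
  exact transpose_mul_mul_apply_eq_cubePull _ _ k i j

end Prepotential

section SiegelAction

variable {E : Type*} [NormedAddCommGroup E] [NormedSpace ℝ E] {n : Type*} [Fintype n] {z : E}
  {δ : Module.Dual ℂ (E →L[ℝ] ℂ)}

lemma matDeriv_const {l m : Type*} (C : Matrix l m ℂ) : matDeriv δ (fun _ : E => C) z = 0 := by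
  ext i j
  simp [matDeriv]

lemma matDeriv_const_mul_add_const {l m : Type*} {A : E → Matrix n m ℂ}
    (hA : ∀ i j, DifferentiableAt ℝ (A · i j) z) (C : Matrix l n ℂ) (D : Matrix l m ℂ) :
    matDeriv δ (fun w => C * A w + D) z = C * matDeriv δ A z := by
  have hC : ∀ i j, DifferentiableAt ℝ (fun _ : E => C i j) z := fun _ _ => differentiableAt_const _
  have hD : ∀ i j, DifferentiableAt ℝ (fun _ : E => D i j) z := fun _ _ => differentiableAt_const _
  rw [matDeriv_add (differentiableAt_mul hC hA) hD, matDeriv_mul (A := fun _ => C) hC hA,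
    matDeriv_const, matDeriv_const, Matrix.zero_mul, zero_add, add_zero]

lemma transpose_mul_matDeriv_mul_of_symplectic [DecidableEq n] {τ σ J : E → Matrix n n ℂ}
    {A B C D : Matrix n n ℂ} (hP : fromBlocks A B C D ∈ symplecticGroup n ℂ)
    (hτ : ∀ i j, DifferentiableAt ℝ (τ · i j) z) (hσ : ∀ i j, DifferentiableAt ℝ (σ · i j) z)
    (hτsymm : (τ z).IsSymm) (hσsymm : (σ z).IsSymm) (hJ : J =ᶠ[𝓝 z] fun w => C * τ w + D)
    (hσJ : (fun w => σ w * J w) =ᶠ[𝓝 z] fun w => A * τ w + B) :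
    (J z)ᵀ * matDeriv δ σ z * J z = matDeriv δ τ z := by
  have hC : ∀ i j, DifferentiableAt ℝ (fun _ : E => C i j) z := fun _ _ => differentiableAt_const _
  have hJdiff : ∀ i j, DifferentiableAt ℝ (J · i j) z := fun i j =>
    ((differentiableAt_mul hC hτ i j).add_const (D i j)).congr_of_eventuallyEq
      (hJ.mono fun w hw => congrFun₂ hw i j)
  have hderiv : matDeriv δ σ z * J z + σ z * (C * matDeriv δ τ z) = A * matDeriv δ τ z := by
    rw [← matDeriv_const_mul_add_const hτ C D, ← matDeriv_congr hJ, ← matDeriv_mul hσ hJdiff,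
      matDeriv_congr hσJ, matDeriv_const_mul_add_const hτ]
  have hJt : (J z)ᵀ = τ z * Cᵀ + Dᵀ := by
    rw [hJ.self_of_nhds, transpose_add, transpose_mul, hτsymm.eq]
  have hJtσ : (J z)ᵀ * σ z = τ z * Aᵀ + Bᵀ := by
    have hσJz : σ z * J z = A * τ z + B := hσJ.self_of_nhds
    rw [← hσsymm.eq, ← transpose_mul, hσJz, transpose_add, transpose_mul, hτsymm.eq]
  obtain ⟨hAC, -, hAD⟩ := SymplecticGroup.fromBlocks_mem_iff.1 hP
  have hDA : Dᵀ * A - Bᵀ * C = 1 := by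
    simpa only [transpose_sub, transpose_mul, transpose_transpose, transpose_one] using
      congrArg transpose hAD
  calc (J z)ᵀ * matDeriv δ σ z * J z
      = (J z)ᵀ * A * matDeriv δ τ z - (J z)ᵀ * σ z * C * matDeriv δ τ z := by
        rw [Matrix.mul_assoc, eq_sub_of_add_eq hderiv, Matrix.mul_sub]
        simp only [Matrix.mul_assoc]
    _ = (τ z * (Cᵀ * A - Aᵀ * C) + (Dᵀ * A - Bᵀ * C)) * matDeriv δ τ z := by
        rw [hJtσ, hJt]
        noncomm_ring [Matrix.add_mul, Matrix.mul_add]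
    _ = matDeriv δ τ z := by rw [hAC, hDA, sub_self, Matrix.mul_zero, zero_add, Matrix.one_mul]

end SiegelAction

section Symplectic

variable {r : ℕ} {F F' : Cn r → ℂ} {φ : Cn r → Cn r} {a : Cn r}

lemma cubePull_thirdPartial_of_symplectic (hF : ContDiffAt ℂ ∞ F a)
    (hF' : ContDiffAt ℂ ∞ F' (φ a)) (hφ : ContDiffAt ℂ ∞ φ a)
    {P : Matrix (Fin r ⊕ Fin r) (Fin r ⊕ Fin r) ℂ} (hP : P ∈ symplecticGroup (Fin r) ℂ)
    {c : Fin r ⊕ Fin r → ℂ}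
    (h : ∀ᶠ w in 𝓝 a, Sum.elim (grad F' (φ w)) (φ w) = P *ᵥ Sum.elim (grad F w) w + c) :
    cubePull (jacobian φ a) (thirdPartial F' (φ a)) = thirdPartial F a := by
  have hlower : φ =ᶠ[𝓝 a] fun w => P.toBlocks₂₁ *ᵥ grad F w + P.toBlocks₂₂ *ᵥ w + c ∘ Sum.inr := by
    filter_upwards [h] with w hw
    rw [← fromBlocks_toBlocks P, fromBlocks_mulVec] at hw
    exact funext fun i => congrFun hw (Sum.inr i)
  have hupper : (fun w => grad F' (φ w)) =ᶠ[𝓝 a]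
      fun w => P.toBlocks₁₁ *ᵥ grad F w + P.toBlocks₁₂ *ᵥ w + c ∘ Sum.inl := by
    filter_upwards [h] with w hw
    rw [← fromBlocks_toBlocks P, fromBlocks_mulVec] at hw
    exact funext fun i => congrFun hw (Sum.inl i)
  have hjac := jacobian_eventuallyEq_of_affine_grad hF hlower
  have hhess : (fun w => hess F' (φ w) * jacobian φ w) =ᶠ[𝓝 a]
      fun w => P.toBlocks₁₁ * hess F w + P.toBlocks₁₂ := by
    filter_upwards [jacobian_eventuallyEq_of_affine_grad hF hupper,
      hφ.continuousAt.eventually (eventually_contDiffAt_infty (hF'.of_le ENat.LEInfty.out)),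
      eventually_contDiffAt_infty (hφ.of_le ENat.LEInfty.out)] with w hw hF'w hφw
    rw [← hw, ← jacobian_grad (hF'w.of_le ENat.LEInfty.out), jacobian_comp
      ((contDiffAt_grad hF'w).differentiableAt (by simp)) (hφw.differentiableAt (by simp))]
  funext k i j
  refine (congrFun₂ (transpose_mul_matDeriv_del_hess_comp_mul hF' hφ k) i j).symm.trans ?_
  rw [transpose_mul_matDeriv_mul_of_symplectic (τ := hess F) ((fromBlocks_toBlocks P).symm ▸ hP)
    (fun i j => ((contDiffAt_hess hF i j).differentiableAt (by simp)).restrictScalars ℝ)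
    (fun i j => ((contDiffAt_hess_comp hF' hφ i j).differentiableAt (by simp)).restrictScalars ℝ)
    (hess_isSymm (hF.of_le ENat.LEInfty.out)) (hess_isSymm (hF'.of_le ENat.LEInfty.out)) hjac hhess,
    matDeriv_del, dz_eq_holPartial ((contDiffAt_hess hF i j).differentiableAt (by simp))]
  rfl

end Symplectic

section Transition

variable {r : ℕ} {M : Type*} [TopologicalSpace M] {e e' e'' : OpenPartialHomeomorph M (Cn r)}
  {z : Cn r}

/-- The Jacobian matrix at `z` of the coordinate change from the chart `e` to the chart `e'`. -/
def jac (e e' : OpenPartialHomeomorph M (Cn r)) (z : Cn r) : Matrix (Fin r) (Fin r) ℂ :=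
  jacobian (fun w => e' (e.symm w)) z

lemma eventually_mem_target_and_symm_mem_source (hz : z ∈ e.target) (hz' : e.symm z ∈ e'.source) :
    ∀ᶠ w in 𝓝 z, w ∈ e.target ∧ e.symm w ∈ e'.source :=
  (e.open_target.eventually_mem hz).and
    ((e.continuousAt_symm hz).eventually (e'.open_source.eventually_mem hz'))

lemma jac_self (hz : z ∈ e.target) : jac e e z = 1 := by
  rw [jac, jacobian_congr (e.eventually_right_inverse hz), jacobian_id]

variable [ChartedSpace (Cn r) M]

lemma mdifferentiable_of_mem_holCharts (he : e ∈ holCharts r M) :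
    e.MDifferentiable 𝓘(ℂ, Cn r) 𝓘(ℂ, Cn r) :=
  ⟨(contMDiffOn_of_mem_maximalAtlas he).mdifferentiableOn (by simp),
    (contMDiffOn_symm_of_mem_maximalAtlas he).mdifferentiableOn (by simp)⟩

lemma contDiffAt_transition (he : e ∈ holCharts r M) (he' : e' ∈ holCharts r M)
    (hz : z ∈ e.target) (hz' : e.symm z ∈ e'.source) :
    ContDiffAt ℂ ∞ (fun w => e' (e.symm w)) z := by
  have h : ContMDiffAt 𝓘(ℂ, Cn r) 𝓘(ℂ, Cn r) ω (fun w => e' (e.symm w)) z :=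
    (contMDiffAt_of_mem_maximalAtlas he' hz').comp z (contMDiffAt_symm_of_mem_maximalAtlas he hz)
  exact h.contDiffAt.of_le (by simp)

lemma differentiableAt_transition (he : e ∈ holCharts r M) (he' : e' ∈ holCharts r M)
    (hz : z ∈ e.target) (hz' : e.symm z ∈ e'.source) :
    DifferentiableAt ℂ (fun w => e' (e.symm w)) z :=
  (contDiffAt_transition he he' hz hz').differentiableAt (by simp)

lemma jac_comp (he : e ∈ holCharts r M) (he' : e' ∈ holCharts r M) (he'' : e'' ∈ holCharts r M)
    (hz : z ∈ e.target) (hz' : e.symm z ∈ e'.source) (hz'' : e.symm z ∈ e''.source) :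
    jac e e'' z = jac e' e'' (e' (e.symm z)) * jac e e' z := by
  have hev : (fun w => e'' (e.symm w)) =ᶠ[𝓝 z] fun w => e'' (e'.symm (e' (e.symm w))) := by
    filter_upwards [eventually_mem_target_and_symm_mem_source hz hz'] with w hw
    rw [e'.left_inv hw.2]
  rw [jac, jacobian_congr hev]
  exact jacobian_comp (ψ := fun v => e'' (e'.symm v)) (differentiableAt_transition he' he''
    (e'.map_source hz') (by rwa [e'.left_inv hz'])) (differentiableAt_transition he he' hz hz')

lemma isUnit_det_jac (he : e ∈ holCharts r M) (he' : e' ∈ holCharts r M) (hz : z ∈ e.target)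
    (hz' : e.symm z ∈ e'.source) : IsUnit (jac e e' z).det := by
  have hinv := jac_comp he he' he hz hz' (e.map_target hz)
  rw [jac_self hz] at hinv
  exact isUnit_det_of_left_inverse hinv.symm

lemma vecCoord_coordVec (he : e ∈ holCharts r M) (he' : e' ∈ holCharts r M) (hz : z ∈ e.target)
    (hz' : e.symm z ∈ e'.source) (a i : Fin r) :
    vecCoord e' (e.symm z) (coordVec e z i) a = jac e e' z a i := by
  let A : Cn r →L[ℂ] Cn r := mfderiv 𝓘(ℂ, Cn r) 𝓘(ℂ, Cn r) e' (e.symm z)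
  let B : Cn r →L[ℂ] Cn r := mfderiv 𝓘(ℂ, Cn r) 𝓘(ℂ, Cn r) e.symm z
  have hcomp : HasFDerivAt (fun w => e' (e.symm w)) (A ∘L B) z := HasMFDerivAt.hasFDerivAt <|
    ((mdifferentiable_of_mem_holCharts he').mdifferentiableAt hz').hasMFDerivAt.comp z
      ((mdifferentiable_of_mem_holCharts he).mdifferentiableAt_symm hz).hasMFDerivAt
  rw [jac, ← fderiv_single_apply (differentiableAt_transition he he' hz hz'),
    hcomp.fderiv]
  rfl

/-- The differential at `z` of the inverse of the chart `e`, which sends the `i`-th standard basis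
vector to `coordVec e z i`; the tangent space at `e.symm z` is identified with the model space. -/
def symmDeriv (e : OpenPartialHomeomorph M (Cn r)) (z : Cn r) : Cn r →L[ℂ] Cn r :=
  mfderiv 𝓘(ℂ, Cn r) 𝓘(ℂ, Cn r) e.symm z

lemma symmDeriv_injective (he : e ∈ holCharts r M) (hz : z ∈ e.target) :
    Function.Injective (symmDeriv e z) :=
  (mdifferentiable_of_mem_holCharts he).symm.mfderiv_injective hz

lemma symmDeriv_single (he : e ∈ holCharts r M) (he' : e' ∈ holCharts r M) (hz : z ∈ e.target)
    (hz' : e.symm z ∈ e'.source) (i : Fin r) :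
    symmDeriv e z (Pi.single i 1) = symmDeriv e' (e' (e.symm z)) ((jac e e' z)ᵀ i) := by
  have hφ := differentiableAt_transition he he' hz hz'
  have hev : e.symm =ᶠ[𝓝 z] fun w => e'.symm (e' (e.symm w)) := by
    filter_upwards [eventually_mem_target_and_symm_mem_source hz hz'] with w hw
    exact (e'.left_inv hw.2).symm
  have hcomp := ((mdifferentiable_of_mem_holCharts he').mdifferentiableAt_symm
    (e'.map_source hz')).hasMFDerivAt.comp (f := fun w => e' (e.symm w)) z
    hφ.hasFDerivAt.hasMFDerivAt
  have hcol : fderiv ℂ (fun w => e' (e.symm w)) z (Pi.single i 1) = (jac e e' z)ᵀ i :=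
    funext fun a => fderiv_single_apply hφ a i
  rw [← hcol, symmDeriv, (hcomp.congr_of_eventuallyEq hev).mfderiv]
  rfl

end Transition

section Metric

variable {r : ℕ} {M : Type*} [TopologicalSpace M] [ChartedSpace (Cn r) M]
  (g : KahlerMetric r M) {e e' : OpenPartialHomeomorph M (Cn r)} {z : Cn r}

lemma KahlerMetric.form_symmDeriv (e : OpenPartialHomeomorph M (Cn r)) (z v w : Cn r) :
    g.form (e.symm z) (symmDeriv e z v) (symmDeriv e z w) = v ⬝ᵥ (g.coeff e z *ᵥ star w) := by
  let B : Cn r →ₗ[ℂ] Cn r →ₗ⋆[ℂ] ℂ := g.form (e.symm z)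
  have hB (i j : Fin r) : B (symmDeriv e z (Pi.single i 1)) (symmDeriv e z (Pi.single j 1)) =
    g.coeff e z i j := rfl
  change B (symmDeriv e z v) (symmDeriv e z w) = _
  conv_lhs => rw [pi_eq_sum_univ' v, pi_eq_sum_univ' w]
  simp only [map_sum, map_smul, map_smulₛₗ, LinearMap.sum_apply, LinearMap.smul_apply]
  simp only [hB, smul_eq_mul, dotProduct_mulVec]
  exact Finset.sum_congr rfl fun j _ => mul_comm _ _

lemma KahlerMetric.coeff_transition (he : e ∈ holCharts r M) (he' : e' ∈ holCharts r M)
    (hz : z ∈ e.target) (hz' : e.symm z ∈ e'.source) :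
    g.coeff e z = (jac e e' z)ᵀ * g.coeff e' (e' (e.symm z)) * (jac e e' z)ᵀᴴ := by
  have hpoint : ∀ {p q : M}, p = q → ∀ u v : Cn r, g.form p u v = g.form q u v := by
    rintro p _ rfl u v
    rfl
  ext i j
  calc g.coeff e z i j
      = g.form (e.symm z) (symmDeriv e z (Pi.single i 1)) (symmDeriv e z (Pi.single j 1)) := rfl
    _ = g.form (e'.symm (e' (e.symm z))) (symmDeriv e' (e' (e.symm z)) ((jac e e' z)ᵀ i))
          (symmDeriv e' (e' (e.symm z)) ((jac e e' z)ᵀ j)) := by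
        rw [symmDeriv_single he he' hz hz', symmDeriv_single he he' hz hz']
        exact hpoint (e'.left_inv hz').symm _ _
    _ = (jac e e' z)ᵀ i ⬝ᵥ (g.coeff e' (e' (e.symm z)) *ᵥ star ((jac e e' z)ᵀ j)) :=
        g.form_symmDeriv e' _ _ _
    _ = _ := by
        rw [Matrix.mul_assoc]
        rfl

lemma KahlerMetric.coeff_posDef (he : e ∈ holCharts r M) (hz : z ∈ e.target) :
    (g.coeff e z).PosDef := by
  refine PosDef.of_dotProduct_mulVec_pos ?_ fun {x} hx => ?_
  · ext i j
    exact (g.hermitian _ _ _).symm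
  · have hne : symmDeriv e z (star x) ≠ 0 :=
      (map_ne_zero_iff _ (symmDeriv_injective he hz)).2 (star_ne_zero.2 hx)
    simpa only [star_star] using (g.pos _ _ hne).trans_eq (g.form_symmDeriv e z _ _)

end Metric

section SpecialCubicForm

variable {r : ℕ} {M : Type*} [TopologicalSpace M] [ChartedSpace (Cn r) M]
  {g : KahlerMetric r M}

namespace SpecialCoordinates

variable {x y : SpecialCoordinates g} {a : Cn r}

/-- The components `-√-1 ∂³F / ∂a^i ∂a^j ∂a^k` of the cubic form in special coordinates. -/
def yukawa (x : SpecialCoordinates g) (a : Cn r) : Fin r → Fin r → Fin r → ℂ :=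
  (-Complex.I) • x.thirdDeriv a

lemma contDiffAt_prepotential (ha : a ∈ x.chart.target) : ContDiffAt ℂ ∞ x.prepotential a :=
  contDiffAt_infty_of_eventually_differentiableAt <|
    (x.chart.open_target.eventually_mem ha).mono fun _ hw =>
      x.holomorphic.differentiableAt (x.chart.open_target.mem_nhds hw)

lemma contDiffAt_yukawa (ha : a ∈ x.chart.target) (i j k : Fin r) :
    ContDiffAt ℂ ∞ (x.yukawa · i j k) a :=
  contDiffAt_const.mul (contDiffAt_thirdPartial (contDiffAt_prepotential ha) i j k)

lemma thirdDeriv_swap_left (ha : a ∈ x.chart.target) (i j k : Fin r) :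
    x.thirdDeriv a i j k = x.thirdDeriv a j i k :=
  thirdPartial_swap_left (contDiffAt_prepotential ha) i j k

lemma thirdDeriv_swap_right (ha : a ∈ x.chart.target) (i j k : Fin r) :
    x.thirdDeriv a i j k = x.thirdDeriv a i k j :=
  thirdPartial_swap_right (contDiffAt_prepotential ha) i j k

lemma hess_prepotential_isSymm (ha : a ∈ x.chart.target) : (hess x.prepotential a).IsSymm :=
  hess_isSymm ((contDiffAt_prepotential ha).of_le ENat.LEInfty.out)

lemma coeff_eq_twoIm (ha : a ∈ x.chart.target) :
    g.coeff x.chart a = twoIm (hess x.prepotential a) := by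
  ext i j
  rw [twoIm_apply_of_isSymm (hess_prepotential_isSymm ha)]
  exact x.metric_eq a ha i j

lemma twoIm_hess_posDef (ha : a ∈ x.chart.target) : (twoIm (hess x.prepotential a)).PosDef :=
  coeff_eq_twoIm ha ▸ g.coeff_posDef x.chart_mem ha

lemma Compatible.cubePull_yukawa (h : x.Compatible y) (ha : a ∈ x.chart.target)
    (ha' : x.chart.symm a ∈ y.chart.source) :
    cubePull (jac x.chart y.chart a) (y.yukawa (y.chart (x.chart.symm a))) = x.yukawa a := by
  obtain ⟨P, hP, c, hPc⟩ := h (x.chart.symm a) ⟨x.chart.map_target ha, ha'⟩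
  have hperiods : ∀ᶠ w in 𝓝 a, Sum.elim (grad y.prepotential (y.chart (x.chart.symm w)))
      (y.chart (x.chart.symm w)) =
        P.map Complex.ofRealHom *ᵥ Sum.elim (grad x.prepotential w) w + c := by
    filter_upwards [(x.chart.continuousAt_symm ha).eventually hPc,
      x.chart.eventually_right_inverse ha] with w hw hwinv
    simp only [periods, hwinv] at hw
    exact hw
  rw [yukawa, cubePull_smul]
  exact congrArg _ (cubePull_thirdPartial_of_symplectic (contDiffAt_prepotential ha)
    (contDiffAt_prepotential (y.chart.map_source ha'))
    (contDiffAt_transition x.chart_mem y.chart_mem ha ha')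
    (SymplecticGroup.map_mem hP Complex.ofRealHom) hperiods)

end SpecialCoordinates

namespace SpecialStructure

variable {S : SpecialStructure g} {e : OpenPartialHomeomorph M (Cn r)} {z : Cn r}
  {x : SpecialCoordinates g}

lemma systemAt_mem (S : SpecialStructure g) (p : M) : S.systemAt p ∈ S.systems :=
  (S.cover p).choose_spec.1

lemma mem_systemAt_source (S : SpecialStructure g) (p : M) : p ∈ (S.systemAt p).chart.source :=
  (S.cover p).choose_spec.2

lemma Y_eq_cubePull_systemAt (S : SpecialStructure g) (he : e ∈ holCharts r M)
    (hz : z ∈ e.target) :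
    S.Y e z = cubePull (jac e (S.systemAt (e.symm z)).chart z)
      ((S.systemAt (e.symm z)).yukawa ((S.systemAt (e.symm z)).chart (e.symm z))) := by
  funext i j k
  simp only [Y, cubicForm, vecCoord_coordVec he (S.systemAt (e.symm z)).chart_mem hz
    (S.mem_systemAt_source (e.symm z))]
  rfl

lemma Y_eq_cubePull (he : e ∈ holCharts r M) (hz : z ∈ e.target) (hx : x ∈ S.systems)
    (hzx : e.symm z ∈ x.chart.source) :
    S.Y e z = cubePull (jac e x.chart z) (x.yukawa (x.chart (e.symm z))) := by
  have hzx₀ := S.mem_systemAt_source (e.symm z)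
  have hcompat := (S.compatible x hx _ (S.systemAt_mem (e.symm z))).cubePull_yukawa
    (x.chart.map_source hzx) (by rwa [x.chart.left_inv hzx])
  rw [x.chart.left_inv hzx] at hcompat
  rw [S.Y_eq_cubePull_systemAt he hz, ← hcompat, cubePull_cubePull,
    jac_comp he x.chart_mem (S.systemAt (e.symm z)).chart_mem hz hzx hzx₀]

lemma Y_chart_eq_yukawa (hx : x ∈ S.systems) {a : Cn r} (ha : a ∈ x.chart.target) :
    S.Y x.chart a = x.yukawa a := by
  rw [Y_eq_cubePull x.chart_mem ha hx (x.chart.map_target ha), jac_self ha, cubePull_one,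
    x.chart.right_inv ha]

lemma differentiableAt_Y (S : SpecialStructure g) (he : e ∈ holCharts r M) (hz : z ∈ e.target)
    (i j k : Fin r) : DifferentiableAt ℂ (S.Y e · i j k) z := by
  obtain ⟨x, hx, hzx⟩ := S.cover (e.symm z)
  have hφ := contDiffAt_transition he x.chart_mem hz hzx
  have hJ (a i : Fin r) : DifferentiableAt ℂ (jac e x.chart · a i) z :=
    (contDiffAt_jacobian hφ a i).differentiableAt (by simp)
  have hy (a b c : Fin r) : DifferentiableAt ℂ (fun w => x.yukawa (x.chart (e.symm w)) a b c) z :=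
    ((SpecialCoordinates.contDiffAt_yukawa (x.chart.map_source hzx) a b c).differentiableAt
      (by simp)).comp (g := (x.yukawa · a b c)) z (hφ.differentiableAt (by simp))
  refine DifferentiableAt.congr_of_eventuallyEq ?_
    ((eventually_mem_target_and_symm_mem_source hz hzx).mono fun w hw =>
      congrFun₃ (Y_eq_cubePull he hw.1 hx hw.2) i j k)
  exact DifferentiableAt.fun_sum fun a _ => DifferentiableAt.fun_sum fun b _ =>
    DifferentiableAt.fun_sum fun c _ => (((hy a b c).mul (hJ a i)).mul (hJ b j)).mul (hJ c k)

lemma cubicForm_swap_left (S : SpecialStructure g) (p : M) (u v w : TangentSpace 𝓘(ℂ, Cn r) p) :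
    S.cubicForm p u v w = S.cubicForm p v u w := by
  have hp := (S.systemAt p).chart.map_source (S.mem_systemAt_source p)
  refine Finset.sum_comm.trans (Finset.sum_congr rfl fun i _ => Finset.sum_congr rfl fun j _ =>
    Finset.sum_congr rfl fun k _ => ?_)
  rw [SpecialCoordinates.thirdDeriv_swap_left hp i j k]
  ring

lemma cubicForm_swap_right (S : SpecialStructure g) (p : M) (u v w : TangentSpace 𝓘(ℂ, Cn r) p) :
    S.cubicForm p u v w = S.cubicForm p u w v := by
  have hp := (S.systemAt p).chart.map_source (S.mem_systemAt_source p)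
  refine Finset.sum_congr rfl fun i _ => Finset.sum_comm.trans (Finset.sum_congr rfl fun k _ =>
    Finset.sum_congr rfl fun j _ => ?_)
  rw [SpecialCoordinates.thirdDeriv_swap_right hp i j k]
  ring

end SpecialStructure

end SpecialCubicForm

section CurvatureFormula

variable {r : ℕ} {M : Type*} [TopologicalSpace M] [ChartedSpace (Cn r) M]
  {g : KahlerMetric r M} {e : OpenPartialHomeomorph M (Cn r)} {z : Cn r} {x : SpecialCoordinates g}

lemma KahlerMetric.chernCurvature_coeff_apply (g : KahlerMetric r M)
    (e : OpenPartialHomeomorph M (Cn r)) (z : Cn r) (i j k l : Fin r) :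
    chernCurvature k l (g.coeff e) z i j = g.riemann e z i j k l := by
  rw [chernCurvature, Matrix.add_apply, Matrix.mul_apply, KahlerMetric.riemann]
  congr 1
  rw [Finset.sum_comm]
  refine Finset.sum_congr rfl fun m _ => ?_
  rw [Matrix.mul_apply, Finset.sum_mul]
  exact Finset.sum_congr rfl fun n _ => congrArg (· * _) (mul_comm _ _)

namespace SpecialCoordinates

lemma coeff_eq_frame (he : e ∈ holCharts r M) (hz : z ∈ e.target)
    (hzx : e.symm z ∈ x.chart.source) :
    g.coeff e z = (jac e x.chart z)ᵀ * twoIm (hess x.prepotential (x.chart (e.symm z))) *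
      (jac e x.chart z)ᵀᴴ := by
  rw [g.coeff_transition he x.chart_mem hz hzx, coeff_eq_twoIm (x.chart.map_source hzx)]

lemma inv_twoIm_hess (he : e ∈ holCharts r M) (hz : z ∈ e.target)
    (hzx : e.symm z ∈ x.chart.source) :
    (twoIm (hess x.prepotential (x.chart (e.symm z))))⁻¹ =
      (jac e x.chart z)ᵀᴴ * g.inv e z * (jac e x.chart z)ᵀ := by
  have hJ : IsUnit (jac e x.chart z)ᵀ.det := by
    rw [det_transpose]
    exact isUnit_det_jac he x.chart_mem hz hzx
  rw [KahlerMetric.inv, coeff_eq_frame he hz hzx, conjTranspose_mul_inv_mul hJ]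

lemma inv_twoIm_hess_eq_transpose (he : e ∈ holCharts r M) (hz : z ∈ e.target)
    (hzx : e.symm z ∈ x.chart.source) :
    (twoIm (hess x.prepotential (x.chart (e.symm z))))⁻¹ =
      jac e x.chart z * (g.inv e z)ᵀ * (jac e x.chart z)ᴴ := by
  have hsymm : (twoIm (hess x.prepotential (x.chart (e.symm z)))).IsSymm :=
    twoIm_isSymm (hess_prepotential_isSymm (x.chart.map_source hzx))
  rw [← hsymm.inv.eq, inv_twoIm_hess he hz hzx, transpose_mul, transpose_mul, transpose_transpose,
    ← Matrix.mul_assoc]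
  rfl

end SpecialCoordinates

namespace SpecialStructure

variable {S : SpecialStructure g}

lemma transpose_jac_mul_matDeriv_mul_jac (he : e ∈ holCharts r M) (hz : z ∈ e.target)
    (hx : x ∈ S.systems) (hzx : e.symm z ∈ x.chart.source) (k : Fin r) :
    (jac e x.chart z)ᵀ * ((-Complex.I) •
      matDeriv (del k) (fun w => hess x.prepotential (x.chart (e.symm w))) z) * jac e x.chart z =
      Matrix.of (S.Y e z k) := by
  rw [Y_eq_cubePull he hz hx hzx, SpecialCoordinates.yukawa, cubePull_smul, Matrix.mul_smul,
    Matrix.smul_mul]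
  exact congrArg ((-Complex.I) • ·) (transpose_mul_matDeriv_del_hess_comp_mul
    (SpecialCoordinates.contDiffAt_prepotential (x.chart.map_source hzx))
    (contDiffAt_transition he x.chart_mem hz hzx) k)

lemma chernCurvature_coeff (S : SpecialStructure g) (he : e ∈ holCharts r M) (hz : z ∈ e.target)
    (k l : Fin r) :
    chernCurvature k l (g.coeff e) z =
      Matrix.of (S.Y e z k) * (g.inv e z)ᵀ * (Matrix.of (S.Y e z l))ᴴ := by
  obtain ⟨x, hx, hzx⟩ := S.cover (e.symm z)
  have hzt := x.chart.map_source hzx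
  have hφ := contDiffAt_transition he x.chart_mem hz hzx
  have hT := contDiffAt_hess_comp (SpecialCoordinates.contDiffAt_prepotential hzt) hφ
  have hframe : g.coeff e =ᶠ[𝓝 z] fun w => (jac e x.chart w)ᵀ *
      twoIm (hess x.prepotential (x.chart (e.symm w))) * (jac e x.chart w)ᵀᴴ :=
    (eventually_mem_target_and_symm_mem_source hz hzx).mono fun w hw =>
      SpecialCoordinates.coeff_eq_frame he hw.1 hw.2
  have hJ : IsUnit (jac e x.chart z)ᵀ.det := by
    rw [det_transpose]
    exact isUnit_det_jac he x.chart_mem hz hzx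
  rw [chernCurvature_congr hframe, chernCurvature_frame
    (L := fun w => (jac e x.chart w)ᵀ) (fun i j => contDiffAt_jacobian hφ j i)
    (fun i j => (contDiffAt_twoIm hT i j).of_le ENat.LEInfty.out) hJ
    ((isUnit_iff_isUnit_det _).1 (SpecialCoordinates.twoIm_hess_posDef hzt).isUnit),
    chernCurvature_twoIm hT, SpecialCoordinates.inv_twoIm_hess_eq_transpose he hz hzx,
    ← transpose_jac_mul_matDeriv_mul_jac he hz hx hzx k,
    ← transpose_jac_mul_matDeriv_mul_jac he hz hx hzx l, conjTranspose_mul, conjTranspose_mul]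
  simp only [Matrix.mul_assoc]

lemma riemann_eq_sum (S : SpecialStructure g) (he : e ∈ holCharts r M) (hz : z ∈ e.target)
    (i j k l : Fin r) :
    g.riemann e z i j k l = ∑ n, ∑ m, g.inv e z n m * S.Y e z k i m * conj (S.Y e z l j n) := by
  rw [← g.chernCurvature_coeff_apply, S.chernCurvature_coeff he hz, Matrix.mul_apply]
  refine Finset.sum_congr rfl fun n _ => ?_
  rw [Matrix.mul_apply, Finset.sum_mul]
  exact Finset.sum_congr rfl fun m _ => congrArg (· * _) (mul_comm _ _)

lemma riemann_eq (S : SpecialStructure g) (he : e ∈ holCharts r M) (hz : z ∈ e.target)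
    (i j k l : Fin r) :
    g.riemann e z i j k l = ∑ n, ∑ m, g.inv e z n m * S.Y e z i k m * conj (S.Y e z j l n) := by
  have hswap (a b c : Fin r) : S.Y e z a b c = S.Y e z b a c := S.cubicForm_swap_left _ _ _ _
  simp only [S.riemann_eq_sum he hz, hswap k, hswap l]

end SpecialStructure

end CurvatureFormula

section SesquilinearSums

variable {n : Type*} [Fintype n]

lemma sum_mul_mul_conj_eq (A : Matrix n n ℂ) (v : n → ℂ) :
    ∑ i, ∑ j, A i j * v i * conj (v j) = v ⬝ᵥ (A *ᵥ star v) := by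
  simp only [dotProduct, mulVec, Finset.mul_sum]
  exact Finset.sum_congr rfl fun i _ => Finset.sum_congr rfl fun j _ => by
    rw [← mul_assoc, mul_comm (v i)]
    rfl

lemma sum_mul_mul_conj_nonneg {A : Matrix n n ℂ} (hA : A.PosSemidef) (v : n → ℂ) :
    0 ≤ ∑ i, ∑ j, A i j * v i * conj (v j) := by
  rw [sum_mul_mul_conj_eq]
  simpa only [star_star] using hA.dotProduct_mulVec_nonneg (star v)

lemma sum_mul_nonneg_of_posSemidef {K : Matrix n n ℂ} (hK : K.PosSemidef) {Q : n → n → ℂ}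
    (hQ : ∀ w : n → ℂ, 0 ≤ ∑ i, ∑ j, Q i j * w i * conj (w j)) :
    0 ≤ ∑ i, ∑ j, K j i * Q i j := by
  classical
  obtain ⟨B, rfl⟩ := CStarAlgebra.nonneg_iff_eq_star_mul_self.1 (nonneg_iff_posSemidef.2 hK)
  have hsum : ∑ i, ∑ j, (star B * B) j i * Q i j =
      ∑ s, ∑ i, ∑ j, Q i j * B s i * conj (B s j) := by
    simp only [Matrix.mul_apply, Finset.sum_mul]
    rw [Finset.sum_comm_cycle]
    refine Finset.sum_congr rfl fun s _ => Finset.sum_congr rfl fun i _ =>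
      Finset.sum_congr rfl fun j _ => ?_
    rw [star_apply, RCLike.star_def]
    ring
  rw [hsum]
  exact Finset.sum_nonneg fun s _ => hQ (B s)

end SesquilinearSums

section Nonnegativity

variable {r : ℕ} {M : Type*} [TopologicalSpace M] [ChartedSpace (Cn r) M]
  {g : KahlerMetric r M} {e : OpenPartialHomeomorph M (Cn r)} {z : Cn r}

lemma KahlerMetric.inv_posDef (he : e ∈ holCharts r M) (hz : z ∈ e.target) :
    (g.inv e z).PosDef :=
  (g.coeff_posDef he hz).inv

namespace SpecialStructure

lemma posSemidef_riemann (S : SpecialStructure g) (he : e ∈ holCharts r M) (hz : z ∈ e.target) :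
    (Matrix.of fun p q : Fin r × Fin r => g.riemann e z p.1 q.1 p.2 q.2).PosSemidef := by
  let A : Matrix (Fin r × Fin r) (Fin r) ℂ := Matrix.of fun p => S.Y e z p.1 p.2
  have hgram : (Matrix.of fun p q : Fin r × Fin r => g.riemann e z p.1 q.1 p.2 q.2) =
      A * (g.inv e z)ᵀ * Aᴴ := by
    ext p q
    rw [Matrix.of_apply, S.riemann_eq he hz, Matrix.mul_apply]
    refine Finset.sum_congr rfl fun n _ => ?_
    rw [Matrix.mul_apply, Finset.sum_mul]
    exact Finset.sum_congr rfl fun m _ => congrArg (· * _) (mul_comm _ _)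
  rw [hgram]
  exact (KahlerMetric.inv_posDef he hz).posSemidef.transpose.mul_mul_conjTranspose_same A

lemma isNakanoNonneg (S : SpecialStructure g) : g.IsNakanoNonneg := by
  intro e he z hz u
  have h := sum_mul_mul_conj_nonneg (S.posSemidef_riemann he hz) fun p => u p.1 p.2
  simp only [Fintype.sum_prod_type, Matrix.of_apply] at h
  exact h.trans_eq (Finset.sum_congr rfl fun i _ => Finset.sum_comm)

end SpecialStructure

namespace KahlerMetric

lemma IsNakanoNonneg.sum_riemann_nonneg (h : g.IsNakanoNonneg) (he : e ∈ holCharts r M)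
    (hz : z ∈ e.target) (v w : Cn r) :
    0 ≤ ∑ i, ∑ j, ∑ k, ∑ l, g.riemann e z i j k l * v i * conj (v j) * w k * conj (w l) := by
  refine (h e he z hz fun i k => v i * w k).trans_eq ?_
  refine Finset.sum_congr rfl fun i _ => Finset.sum_congr rfl fun j _ =>
    Finset.sum_congr rfl fun k _ => Finset.sum_congr rfl fun l _ => ?_
  rw [map_mul]
  ring

lemma IsNakanoNonneg.isBisectionalNonneg (h : g.IsNakanoNonneg) : g.IsBisectionalNonneg := by
  intro e he z hz v w _ _
  have hnorm := sum_mul_mul_conj_nonneg (g.coeff_posDef he hz).posSemidef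
  exact mul_nonneg (h.sum_riemann_nonneg he hz v w)
    (inv_nonneg.2 (mul_nonneg (hnorm v) (hnorm w)))

lemma IsNakanoNonneg.isRicciNonneg (h : g.IsNakanoNonneg) : g.IsRicciNonneg := by
  intro e he z hz v
  have htrace : 0 ≤ ∑ i, ∑ j, g.inv e z j i *
      ∑ k, ∑ l, g.riemann e z i j k l * v k * conj (v l) := by
    refine sum_mul_nonneg_of_posSemidef (inv_posDef he hz).posSemidef fun w => ?_
    refine (h.sum_riemann_nonneg he hz w v).trans_eq ?_
    simp only [Finset.sum_mul]
    refine Finset.sum_congr rfl fun i _ => Finset.sum_congr rfl fun j _ =>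
      Finset.sum_congr rfl fun k _ => Finset.sum_congr rfl fun l _ => by ring
  refine htrace.trans_eq ?_
  simp only [ricci, Finset.mul_sum, Finset.sum_mul, ← mul_assoc]
  exact (Finset.sum_comm_cycle.trans (Finset.sum_congr rfl fun i _ => Finset.sum_comm_cycle)).symm

end KahlerMetric

end Nonnegativity

section ScalarCurvature

variable {r : ℕ} {M : Type*} [TopologicalSpace M] [ChartedSpace (Cn r) M]
  {g : KahlerMetric r M} {e : OpenPartialHomeomorph M (Cn r)} {z : Cn r} {x : SpecialCoordinates g}

namespace SpecialStructure

variable {S : SpecialStructure g}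

lemma scalarIn_eq_cubeNorm (S : SpecialStructure g) (he : e ∈ holCharts r M)
    (hz : z ∈ e.target) : g.scalarIn e z = cubeNorm (g.inv e z) (S.Y e z) := by
  simp only [KahlerMetric.scalarIn, KahlerMetric.ricci, S.riemann_eq_sum he hz]
  exact sum_contraction_eq_cubeNorm _ _

lemma scalarIn_eq_normSqY (S : SpecialStructure g) (he : e ∈ holCharts r M) (hz : z ∈ e.target) :
    g.scalarIn e z = S.normSqY e z :=
  (S.scalarIn_eq_cubeNorm he hz).trans (cubeNorm_eq_sum _ _)

lemma scalarIn_eq_cubeNorm_yukawa (he : e ∈ holCharts r M) (hz : z ∈ e.target)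
    (hx : x ∈ S.systems) (hzx : e.symm z ∈ x.chart.source) :
    g.scalarIn e z = cubeNorm (twoIm (hess x.prepotential (x.chart (e.symm z))))⁻¹
      (x.yukawa (x.chart (e.symm z))) := by
  rw [S.scalarIn_eq_cubeNorm he hz, Y_eq_cubePull he hz hx hzx, cubeNorm_cubePull,
    SpecialCoordinates.inv_twoIm_hess he hz hzx]

variable [IsManifold 𝓘(ℂ, Cn r) ω M]

lemma scalar_eq_cubeNorm_yukawa {p : M} (hx : x ∈ S.systems) (hp : p ∈ x.chart.source) :
    (g.scalar p : ℂ) =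
      cubeNorm (twoIm (hess x.prepotential (x.chart p)))⁻¹ (x.yukawa (x.chart p)) := by
  have hpp := (chartAt (Cn r) p).left_inv (mem_chart_source (Cn r) p)
  have hscalarIn := scalarIn_eq_cubeNorm_yukawa (S := S) (x := x)
    (IsManifold.chart_mem_maximalAtlas (I := 𝓘(ℂ, Cn r)) (n := ω) p) (mem_chart_target (Cn r) p)
    hx (by rwa [hpp])
  rw [hpp] at hscalarIn
  have hnonneg := cubeNorm_nonneg
    (SpecialCoordinates.twoIm_hess_posDef (x.chart.map_source hp)).inv.posSemidef.nonneg
    (x.yukawa (x.chart p))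
  rw [KahlerMetric.scalar, hscalarIn]
  exact (Complex.eq_re_of_ofReal_le hnonneg).symm

lemma scalarIn_eq_scalar (S : SpecialStructure g) (he : e ∈ holCharts r M) (hz : z ∈ e.target) :
    g.scalarIn e z = (g.scalar (e.symm z) : ℂ) := by
  obtain ⟨x, hx, hzx⟩ := S.cover (e.symm z)
  rw [scalarIn_eq_cubeNorm_yukawa he hz hx hzx, scalar_eq_cubeNorm_yukawa hx hzx]

lemma Y_eq_zero_of_scalar_eq_zero (S : SpecialStructure g) (he : e ∈ holCharts r M)
    (hz : z ∈ e.target) (h : g.scalar (e.symm z) = 0) (i j k : Fin r) : S.Y e z i j k = 0 := by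
  refine eq_zero_of_cubeNorm_eq_zero (KahlerMetric.inv_posDef (g := g) he hz) ?_ i j k
  rw [← S.scalarIn_eq_cubeNorm he hz, S.scalarIn_eq_scalar he hz, h, Complex.ofReal_zero]

lemma cubicForm_eq_zero_of_scalar_eq_zero (S : SpecialStructure g) {p : M} (h : g.scalar p = 0)
    (u v w : TangentSpace 𝓘(ℂ, Cn r) p) : S.cubicForm p u v w = 0 := by
  have hp := S.mem_systemAt_source p
  have ha := (S.systemAt p).chart.map_source hp
  have hyukawa (i j k : Fin r) : (S.systemAt p).yukawa ((S.systemAt p).chart p) i j k = 0 := by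
    rw [← Y_chart_eq_yukawa (S.systemAt_mem p) ha]
    exact S.Y_eq_zero_of_scalar_eq_zero (S.systemAt p).chart_mem ha
      (by rwa [(S.systemAt p).chart.left_inv hp]) i j k
  refine Finset.sum_eq_zero fun i _ => Finset.sum_eq_zero fun j _ =>
    Finset.sum_eq_zero fun k _ => ?_
  refine mul_eq_zero_of_left (mul_eq_zero_of_left (mul_eq_zero_of_left ?_ _) _) _
  exact hyukawa i j k

lemma riemann_eq_zero_of_scalar_eq_zero (S : SpecialStructure g) (he : e ∈ holCharts r M)
    (hz : z ∈ e.target) (h : g.scalar (e.symm z) = 0) (i j k l : Fin r) :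
    g.riemann e z i j k l = 0 := by
  rw [S.riemann_eq he hz]
  simp only [S.Y_eq_zero_of_scalar_eq_zero he hz h, mul_zero, zero_mul, Finset.sum_const_zero]

lemma isPlurisubharmonic_scalar (S : SpecialStructure g) :
    IsPlurisubharmonic (r := r) g.scalar := by
  intro e he
  have hlocal : ∀ z ∈ e.target, ContDiffAt ℝ ∞ (fun w => g.scalar (e.symm w)) z ∧
      ∀ v, 0 ≤ levi (fun w => (g.scalar (e.symm w) : ℂ)) z v := by
    intro z hz
    obtain ⟨x, hx, hzx⟩ := S.cover (e.symm z)
    have hzt := x.chart.map_source hzx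
    have hφ := contDiffAt_transition he x.chart_mem hz hzx
    have hnear := eventually_mem_target_and_symm_mem_source hz hzx
    have hT := contDiffAt_hess_comp (SpecialCoordinates.contDiffAt_prepotential hzt) hφ
    have hy (i j k : Fin r) : ContDiffAt ℂ ∞ (fun w => x.yukawa (x.chart (e.symm w)) i j k) z :=
      (SpecialCoordinates.contDiffAt_yukawa hzt i j k).comp (g := (x.yukawa · i j k)) z hφ
    have hH := hnear.mono fun w hw =>
      SpecialCoordinates.twoIm_hess_posDef (x.chart.map_source hw.2)
    have hscalar := hnear.mono fun w hw => scalar_eq_cubeNorm_yukawa (S := S) hx hw.2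
    exact ⟨contDiffAt_of_eventually_eq_cubeNorm_inv_twoIm hT hH.self_of_nhds hy hscalar,
      levi_cubeNorm_inv_twoIm_nonneg hT hH hy hscalar⟩
  exact ⟨fun z hz => (hlocal z hz).1.contDiffWithinAt, fun z hz => (hlocal z hz).2⟩

end SpecialStructure

end ScalarCurvature

end SpecialKahler

end

theorem mainTheorem5 {r : ℕ} {M : Type*} [TopologicalSpace M] [ChartedSpace (Cn r) M]
    [IsManifold 𝓘(ℂ, Cn r) ω M] (g : KahlerMetric r M) (S : SpecialStructure g) :
    -- `Y` is `-√-1 ∂³F` in all special coordinates, and is symmetric and holomorphic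
    (∀ x ∈ S.systems, ∀ a ∈ x.chart.target, ∀ i j k,
      S.Y x.chart a i j k = -Complex.I * x.thirdDeriv a i j k) ∧
    (∀ p u v w, S.cubicForm p u v w = S.cubicForm p v u w ∧
      S.cubicForm p u v w = S.cubicForm p u w v) ∧
    (∀ e ∈ holCharts r M, ∀ i j k, DifferentiableOn ℂ (fun z => S.Y e z i j k) e.target) ∧
    -- the curvature formula, in all holomorphic coordinates
    (∀ e ∈ holCharts r M, ∀ z ∈ e.target, ∀ i j k l,
      g.riemann e z i j k l =
        ∑ n, ∑ m, g.inv e z n m * S.Y e z i k m * conj (S.Y e z j l n)) ∧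
    -- (1)
    g.IsNakanoNonneg ∧ g.IsBisectionalNonneg ∧ g.IsRicciNonneg ∧
    -- (2)
    (∀ e ∈ holCharts r M, ∀ z ∈ e.target,
      g.scalarIn e z = (g.scalar (e.symm z) : ℂ) ∧
      (g.scalar (e.symm z) : ℂ) = S.normSqY e z) ∧
    (∀ p : M, g.scalar p = 0 →
      (∀ u v w, S.cubicForm p u v w = 0) ∧
      ∀ e ∈ holCharts r M, p ∈ e.source → ∀ i j k l, g.riemann e (e p) i j k l = 0) ∧
    -- (3)
    IsPlurisubharmonic (r := r) g.scalar := by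
  refine ⟨fun x hx a ha i j k => ?_, fun p u v w => ?_, fun e he i j k z hz => ?_,
    fun e he z hz => S.riemann_eq he hz, S.isNakanoNonneg,
    S.isNakanoNonneg.isBisectionalNonneg, S.isNakanoNonneg.isRicciNonneg,
    fun e he z hz => ⟨S.scalarIn_eq_scalar he hz, ?_⟩, fun p hR => ⟨?_, fun e he hp => ?_⟩,
    S.isPlurisubharmonic_scalar⟩
  · rw [SpecialStructure.Y_chart_eq_yukawa hx ha]
    rfl
  · exact ⟨S.cubicForm_swap_left p u v w, S.cubicForm_swap_right p u v w⟩
  · exact (S.differentiableAt_Y he hz i j k).differentiableWithinAt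
  · rw [← S.scalarIn_eq_scalar he hz, S.scalarIn_eq_normSqY he hz]
  · exact S.cubicForm_eq_zero_of_scalar_eq_zero hR
  · exact S.riemann_eq_zero_of_scalar_eq_zero he (e.map_source hp) (by rwa [e.left_inv hp])
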